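/- Let $\mathbb F_q$ be a finite field and let $F/\mathbb F_q$ be an algebraic function field of one variable (a finite extension of $\mathbb F_q(x)$ for some $x\in F$ transcendental over $\mathbb F_q$). A place $P$ of a function field is given by its valuation ring $\mathcal O_P$ (a proper valuation subring containing $\mathbb F_q$); $k(P)$ denotes its residue class field, $\deg P=[k(P):\mathbb F_q]$ its degree ($P$ is rational if $\deg P=1$), $v_P$ its normalized discrete valuation, and $e(P'|P)$ the ramification index of a place $P'$ lying over $P$. Let $S$ be a finite set of places of $F$, let $F'/F$ be a finite separable extension, and let $N\subset\mathbb N$ be a finite set with $m=\sum_{i\in N} i$. Suppose that $F$ has a rational place $Q$ which has a rational extension $Q'$ in $F'$ with $\gcd(m,e(Q'|Q))=1$. For $i\in N$ let $p_i(T)\in F[T]$ be a monic polynomial of degree $i$ all of whose coefficients lie in $\mathcal O_Q$ and in $\mathcal O_P$ for every $P\in S$ (for instance $p_i\in\mathbb F_q[T]$), and let $\alpha\in F$. Suppose that (a) for all $P\in S$ and $i\in N$, the reduction of $p_i(T)$ modulo $P$ is irreducible over $k(P)$; (b) $\alpha(P)=0$ for all $P\in S$; (c) $v_Q(\alpha)<0$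 and $\gcd(v_Q(\alpha),m)=1$. Let $E=F(z)$, where $z$ is a root of $$\varphi(T)=\prod_{i\in N}p_i(T)-\alpha\in F[T],$$ and let $E'=EF'$ be a compositum of $E$ and $F'$ over $F$. Then: - If $S\neq\emptyset$, then $E'/F$ is a separable extension. - (i) $Q$ is totally ramified in $E$ (it has exactly one extension in $E$, and its ramification index is $[E:F]$), $[E:F]=[E':F']=m$, and $\mathbb F_q$ is algebraically closed in $E'$. - (ii) For each $P\in S$ and each $i\in N$, there is exactly one place of $E$ lying over $P$ that has degree $i\cdot\deg P$. - (iii) If $P\in S$ splits completely in $F'$ (it has exactly $[F':F]$ extensions in $F'$), then each extension of $P$ in $E$ splits completely in $E'$ (it has exactly $[E':E]$ extensions in $E'$). -/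

import Mathlib

namespace AlgFunctionField

open Polynomial

/-- `F / k` is an algebraic function field (of one variable): `F` is a finite extension of `k(x)`
for some `x ∈ F` that is transcendental over `k`. -/
def IsFunctionField (k F : Type*) [Field k] [Field F] [Algebra k F] : Prop :=
  ∃ x : F, Transcendental k x ∧ FiniteDimensional (IntermediateField.adjoin k {x}) F

/-- A place of `F / k`, given by its valuation ring `𝒪_P`: a valuation ring of `F` which contains
`k` and is different from `F`. The place as an ideal is the maximal ideal of `𝒪_P`. -/
structure Place (k F : Type*) [Field k] [Field F] [Algebra k F] where
  /-- The valuation ring `𝒪_P`. -/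
  ring : ValuationSubring F
  algebraMap_mem : ∀ c : k, algebraMap k F c ∈ ring
  ne_top : ring ≠ ⊤

namespace Place

variable {k F L : Type*} [Field k] [Field F] [Algebra k F] [Field L] [Algebra k L] [Algebra F L]

/-- The structure of a `k`-algebra on `𝒪_P`. -/
noncomputable instance (P : Place k F) : Algebra k P.ring :=
  ((algebraMap k F).codRestrict P.ring P.algebraMap_mem).toAlgebra

/-- The residue class field `k(P)`; it is a `k`-algebra through `k → 𝒪_P → k(P)`. -/
abbrev ResidueField (P : Place k F) : Type _ := IsLocalRing.ResidueField P.ring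

/-- The degree `deg P = [k(P) : k]`. A place is rational if its degree is `1`. -/
noncomputable def deg (P : Place k F) : ℕ := Module.finrank k P.ResidueField

/-- `x(P) = 0`: the function `x` is regular at `P` and its residue class in `k(P)` is zero. -/
def Vanishes (P : Place k F) (x : F) : Prop :=
  ∃ a : P.ring, (a : F) = x ∧ IsLocalRing.residue P.ring a = 0

/-- All coefficients of `f` lie in `𝒪_P`. -/
def IntegralAt (P : Place k F) (f : F[X]) : Prop := ∀ j, f.coeff j ∈ P.ring

/-- All coefficients of `f` lie in `𝒪_P`, and the polynomial over `k(P)` obtained by reducing them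
modulo `P` is irreducible. -/
def IrreducibleAt (P : Place k F) (f : F[X]) : Prop :=
  ∃ g : P.ring[X], g.map (algebraMap P.ring F) = f ∧ Irreducible (g.map (IsLocalRing.residue P.ring))

/-- `t` is a prime element (uniformizer) of `P`: it generates the maximal ideal of `𝒪_P`. -/
def IsPrimeElement (P : Place k F) (t : P.ring) : Prop :=
  IsLocalRing.maximalIdeal P.ring = Ideal.span {t}

open Classical in
/-- The discrete valuation `v_P` at a nonzero `x`: `v_P(x) = n` if `x = t ^ n * u` with `t` a prime
element of `P` and `u` a unit of `𝒪_P`. (At `x = 0`, where `v_P(0) = ∞`, the value here is `0`.) -/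
noncomputable def ord (P : Place k F) (x : F) : ℤ :=
  if h : ∃ n : ℤ, ∃ (t : P.ring) (u : P.ringˣ),
      P.IsPrimeElement t ∧ x = (t : F) ^ n * ((u : P.ring) : F)
  then h.choose else 0

theorem IsPrimeElement.ne_zero {P : Place k F} {t : P.ring} (ht : P.IsPrimeElement t) :
    t ≠ 0 := by
  rintro rfl
  have hbot : IsLocalRing.maximalIdeal P.ring = ⊥ := by
    rw [ht, Ideal.span_singleton_eq_bot]
  refine P.ne_top (top_unique fun x _ => ?_)
  rcases P.ring.mem_or_inv_mem x with h | h
  · exact h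
  · by_cases hx : x = 0
    · simp [hx]
    have hu : IsUnit (⟨x⁻¹, h⟩ : P.ring) := by
      by_contra hn
      have h0 := (IsLocalRing.mem_maximalIdeal _).2 hn
      rw [hbot, Ideal.mem_bot] at h0
      exact hx (by simpa using congrArg Subtype.val h0)
    obtain ⟨w, hw⟩ := hu.exists_right_inv
    have hw' : x⁻¹ * (w : F) = 1 := congrArg Subtype.val hw
    have : x = w := by field_simp at hw'; exact hw'.symm
    rw [this]; exact w.2

/-- The integer `n` in the definition of `ord` is unique. -/
theorem ord_eq (P : Place k F) {t : P.ring} (ht : P.IsPrimeElement t) (u : P.ringˣ) (n : ℤ) :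
    P.ord ((t : F) ^ n * ((u : P.ring) : F)) = n := by
  have hex : ∃ n' : ℤ, ∃ (t' : P.ring) (u' : P.ringˣ), P.IsPrimeElement t' ∧
      (t : F) ^ n * ((u : P.ring) : F) = (t' : F) ^ n' * ((u' : P.ring) : F) := ⟨n, t, u, ht, rfl⟩
  rw [ord, dif_pos hex]
  obtain ⟨t', u', ht', h⟩ := hex.choose_spec
  generalize hex.choose = n' at h
  have hv1 : ∀ w : P.ringˣ, P.ring.valuation ((w : P.ring) : F) = 1 := fun w =>
    P.ring.valuation_unit w
  have hlt : P.ring.valuation (t : F) < 1 :=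
    (P.ring.valuation_lt_one_iff t).1 (ht ▸ Ideal.mem_span_singleton_self t)
  have hpos : 0 < P.ring.valuation (t : F) := by
    rw [zero_lt_iff, Valuation.ne_zero_iff]
    exact fun h0 => ht.ne_zero (Subtype.ext h0)
  obtain ⟨w, hw⟩ : Associated t t' := Ideal.span_singleton_eq_span_singleton.1 (ht.symm.trans ht')
  have htt : P.ring.valuation (t' : F) = P.ring.valuation (t : F) := by
    rw [← hw]
    simp [hv1]
  have h2 := congrArg P.ring.valuation h
  rw [map_mul, map_mul, map_zpow₀, map_zpow₀, hv1, hv1, htt, mul_one, mul_one] at h2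
  exact (zpow_right_injective₀ hpos hlt.ne h2).symm

/-- The place `P'` of `L` lies over the place `P` of `F`: `𝒪_P = 𝒪_{P'} ∩ F`. -/
def LiesOver (P' : Place k L) (P : Place k F) : Prop :=
  P'.ring.comap (algebraMap F L) = P.ring

open Classical in
/-- The ramification index `e(P'|P)` of a place `P'` of `L` over a place `P` of `F`: the integer `e`
with `v_{P'}(x) = e * v_P(x)` for all `x ∈ F`. -/
noncomputable def ramificationIdx (P' : Place k L) (P : Place k F) : ℕ :=
  if h : ∃ e : ℕ, ∀ x : F, P'.ord (algebraMap F L x) = e * P.ord x then h.choose else 0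

variable (L) in
/-- `P` is totally ramified in `L / F`: there is exactly one place `P'` of `L` over `P`, and
`e(P'|P) = [L : F]`. -/
def TotallyRamified (P : Place k F) : Prop :=
  ∃ P' : Place k L, (∀ R : Place k L, R.LiesOver P ↔ R = P') ∧
    P'.ramificationIdx P = Module.finrank F L

variable (L) in
/-- `P` splits completely in the finite extension `L / F`: there are exactly `[L : F]` places of
`L` over `P`. -/
def SplitsCompletely (P : Place k F) : Prop :=
  {P' : Place k L | P'.LiesOver P}.ncard = Module.finrank F L

end Place

end AlgFunctionField

/-!
Every place of a function field is a discrete valuation: for `t ≠ 0` in the maximal ideal,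
representatives of `k`-independent classes in `𝒪_P / t` are independent over `k(t)`, so `𝒪_P / t` is
finite over `k` (`Place.finite_quotient_span`). Hence the residue class field is finite over `k`
and `𝒪_P` is a Noetherian valuation ring. Everything else is done with valuations, by hand; no
integral closures are needed.

*The place `Q`.* Let `g = ∏ p_i`, of degree `m`, and let `R` be a place over `Q`. Since `α = g(z)` has
a pole, so has `z`, and `v_R(z) ^ m = v_R(α)`. As `ord_Q α` is prime to `m`, the values of nonzero
terms `c_j z ^ j`, `j < m`, are pairwise distinct, so the value of `∑ c_j z ^ j` is that of its
dominant term (`Place.LiesOver.exists_valuation_aeval_eq`). This gives at once that `1, …, z ^ (m-1)`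
is a basis, that `𝒪_R` is determined by `Q`, that `e(R|Q) = m`, and, when `Q` is rational, that each
constant is congruent to an element of `k` modulo `R`, hence lies in `k`. The argument applies both
to `E / F` with `Q` and to `E' / F'` with `Q'`, because `gcd(m, e(Q'|Q)) = 1`.

*The places in `S`.* Modulo `P ∈ S` the polynomial `φ` is the product of the distinct irreducible
polynomials `p_i`. So `φ` is separable, and a place over `P` is a zero of some `p_i(z)`. Conversely the
ideal `(P, p_i(z))` of `𝒪_P[z]` is proper, hence lies under a place. In the local ring of `𝒪_P[z]` at
that ideal, `p_i(z)` is `α` times a unit, so that the maximal ideal is generated by a prime element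
`t` of `P`, and every element of the field is a power of `t` times a unit
(`Place.LiesOver.exists_eq_zpow_mul_div`). So the place is unique, and its residue class field is
`k(P)[T] / p_i`, of degree `i` over `k(P)`.

*Complete splitting.* If `P` splits completely in `F'`, weak approximation shows that the places over
`P` have residue class field `k(P)`
(`Place.SplitsCompletely.exists_valuation_sub_algebraMap_lt_one`). Thus the `p_i` remain irreducible
modulo these places, and by the above, applied to `E' / F'`, restriction to `F'` is a bijection from
the places of `E'` over a given place of `E` over `P` to the places of `F'` over `P`; and
`[E' : E] = [F' : F]`.
-/

namespace AlgFunctionField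

open Polynomial

/-! ### Function fields -/

namespace IsFunctionField

variable {k F : Type*} [Field k] [Field F] [Algebra k F]

theorem essFiniteType (hF : IsFunctionField k F) : Algebra.EssFiniteType k F := by
  obtain ⟨x, -, hfin⟩ := hF
  have h1 : Algebra.EssFiniteType k (IntermediateField.adjoin k {x}) :=
    IntermediateField.essFiniteType_iff.2
      (IntermediateField.fg_adjoin_of_finite (Set.finite_singleton x))
  exact Algebra.EssFiniteType.comp k (IntermediateField.adjoin k {x}) F

theorem trdeg_le_one (hF : IsFunctionField k F) : Algebra.trdeg k F ≤ 1 := by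
  obtain ⟨x, -, hfin⟩ := hF
  have h1 : Algebra.IsAlgebraic (Algebra.adjoin k {x}) F := by
    open scoped IntermediateField.algebraAdjoinAdjoin in
    exact Algebra.IsAlgebraic.trans (Algebra.adjoin k {x}) (IntermediateField.adjoin k {x}) F
  simpa using Algebra.IsAlgebraic.trdeg_le_cardinalMk k ({x} : Set F)

end IsFunctionField

theorem finiteDimensional_adjoin_of_trdeg_le_one {k F : Type*} [Field k] [Field F] [Algebra k F]
    [Algebra.EssFiniteType k F] (h : Algebra.trdeg k F ≤ 1) {t : F} (ht : Transcendental k t) :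
    FiniteDimensional (IntermediateField.adjoin k {t}) F := by
  have hb : IsTranscendenceBasis k (fun _ : Unit => t) := by
    refine AlgebraicIndependent.isTranscendenceBasis_of_lift_trdeg_le_of_finite
      (algebraicIndependent_unique_type_iff.2 ht) ?_
    simpa using h
  have halg := hb.isAlgebraic_field
  rw [Set.range_const] at halg
  have : Algebra.EssFiniteType (IntermediateField.adjoin k {t}) F :=
    Algebra.EssFiniteType.of_comp k _ F
  exact Algebra.finite_of_essFiniteType_of_isAlgebraic

namespace IsFunctionField

variable {k F : Type*} [Field k] [Field F] [Algebra k F]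

theorem finiteDimensional_adjoin (hF : IsFunctionField k F) {t : F} (ht : Transcendental k t) :
    FiniteDimensional (IntermediateField.adjoin k {t}) F :=
  have := hF.essFiniteType
  finiteDimensional_adjoin_of_trdeg_le_one hF.trdeg_le_one ht

theorem of_finiteDimensional (hF : IsFunctionField k F) (L : Type*) [Field L] [Algebra k L]
    [Algebra F L] [IsScalarTower k F L] [FiniteDimensional F L] : IsFunctionField k L := by
  have h1 := hF.essFiniteType
  have h2 : Algebra.EssFiniteType k L := Algebra.EssFiniteType.comp k F L
  have h3 : Algebra.trdeg k L ≤ 1 := by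
    have h4 := lift_trdeg_add_eq k F L
    rw [trdeg_eq_zero_iff.2 (inferInstance : Algebra.IsAlgebraic F L)] at h4
    have h5 := Cardinal.lift_le.2 hF.trdeg_le_one
    simp only [Cardinal.lift_zero, add_zero] at h4
    rw [h4] at h5
    simpa using h5
  obtain ⟨x, hx, -⟩ := hF
  have hx' : Transcendental k (algebraMap F L x) :=
    (transcendental_algebraMap_iff (algebraMap F L).injective).2 hx
  exact ⟨_, hx', finiteDimensional_adjoin_of_trdeg_le_one h3 hx'⟩

end IsFunctionField

/-! ### Places are discrete -/

namespace Place

variable {k F : Type*} [Field k] [Field F] [Algebra k F]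

instance (P : Place k F) : IsScalarTower k P.ring F := IsScalarTower.of_algebraMap_eq fun _ => rfl

theorem mem_ring_of_isAlgebraic (P : Place k F) {x : F} (hx : IsAlgebraic k x) : x ∈ P.ring := by
  have h : IsIntegral P.ring x := hx.isIntegral.tower_top
  obtain ⟨y, hy⟩ := IsIntegrallyClosed.isIntegral_iff.1 h
  rw [← hy]
  exact y.2

theorem eq_zero_of_isAlgebraic (P : Place k F) {x : F} (hx : IsAlgebraic k x)
    (hv : P.ring.valuation x < 1) : x = 0 := by
  by_contra h0
  have h := (P.ring.valuation_le_one_iff _).2 (P.mem_ring_of_isAlgebraic hx.inv)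
  rw [map_inv₀, inv_le_one₀ (by simpa [zero_lt_iff] using h0)] at h
  exact absurd hv (not_lt.2 h)

theorem transcendental_of_mem_maximalIdeal (P : Place k F) {t : P.ring} (h0 : t ≠ 0)
    (ht : t ∈ IsLocalRing.maximalIdeal P.ring) : Transcendental k (t : F) := fun h =>
  h0 (Subtype.ext (P.eq_zero_of_isAlgebraic h ((P.ring.valuation_lt_one_iff t).1 ht)))

/-- Representatives of `k`-linearly independent classes in `𝒪_P / t` are linearly independent over
`k(t)`: in a relation with polynomial coefficients in `t`, the constant coefficients vanish modulo
`t`, so the relation can be divided by `t`. Hence the dimension is at most `[F : k(t)]`. -/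
theorem finite_quotient_span (P : Place k F) (hF : IsFunctionField k F) {t : P.ring} (h0 : t ≠ 0)
    (ht : t ∈ IsLocalRing.maximalIdeal P.ring) :
    Module.Finite k (P.ring ⧸ Ideal.span {t}) := by
  have hfin := hF.finiteDimensional_adjoin (P.transcendental_of_mem_maximalIdeal h0 ht)
  let b := Module.Free.chooseBasis k (P.ring ⧸ Ideal.span {t})
  choose y hy using fun i => Ideal.Quotient.mk_surjective (b i)
  have hzero : ∀ (s : Finset (Module.Free.ChooseBasisIndex k (P.ring ⧸ Ideal.span {t})))
      (f : Module.Free.ChooseBasisIndex k (P.ring ⧸ Ideal.span {t}) → k[X]),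
      ∑ i ∈ s, aeval t (f i) * y i = 0 → ∀ i ∈ s, (f i).coeff 0 = 0 := by
    intro s f hf
    have h1 := congrArg (Ideal.Quotient.mk (Ideal.span {t})) hf
    rw [map_sum, map_zero] at h1
    refine linearIndependent_iff'.1 b.linearIndependent s (fun i => (f i).coeff 0) ?_
    rw [← h1]
    refine Finset.sum_congr rfl fun i _ => ?_
    rw [map_mul, hy, Algebra.smul_def]
    congr 1
    conv_rhs => rw [← divX_mul_X_add (f i)]
    have h2 : Ideal.Quotient.mk (Ideal.span {t}) t = 0 :=
      Ideal.Quotient.eq_zero_iff_mem.2 (Ideal.mem_span_singleton_self t)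
    simp only [map_add, map_mul, aeval_X, aeval_C, h2, mul_zero, zero_add]
    rfl
  have key : ∀ (n : ℕ) (s : Finset (Module.Free.ChooseBasisIndex k (P.ring ⧸ Ideal.span {t})))
      (f : Module.Free.ChooseBasisIndex k (P.ring ⧸ Ideal.span {t}) → k[X]),
      ∑ i ∈ s, aeval t (f i) * y i = 0 → ∀ i ∈ s, (f i).coeff n = 0 := by
    intro n
    induction n with
    | zero => exact hzero
    | succ n ih =>
      intro s f hf i hi
      rw [← coeff_divX]
      refine ih s (fun i => (f i).divX) ?_ i hi
      refine (mul_eq_zero.1 ?_).resolve_left h0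
      rw [← hf, Finset.mul_sum]
      refine Finset.sum_congr rfl fun j hj => ?_
      conv_rhs => rw [← divX_mul_X_add (f j), hzero s f hf j hj]
      simp only [map_mul, aeval_X, map_zero, add_zero]
      ring
  have hli : LinearIndependent (IntermediateField.adjoin k {(t : F)}) (fun i => (y i : F)) := by
    open scoped IntermediateField.algebraAdjoinAdjoin in
    rw [← LinearIndependent.iff_fractionRing (Algebra.adjoin k {(t : F)}), linearIndependent_iff']
    intro s g hg i hi
    have hg' : ∀ i, ∃ f : k[X], aeval (t : F) f = g i := fun i => by
      have h : (g i : F) ∈ (aeval (t : F) : k[X] →ₐ[k] F).range :=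
        Algebra.adjoin_singleton_eq_range_aeval k (t : F) ▸ (g i).2
      exact h
    choose f hf using hg'
    have h1 : ∑ i ∈ s, aeval t (f i) * y i = 0 := by
      apply Subtype.ext
      refine Eq.trans ?_ hg
      push_cast
      refine Finset.sum_congr rfl fun j _ => ?_
      rw [Algebra.smul_def]
      congr 1
      exact (aeval_algebraMap_apply F t (f j)).symm.trans (hf j)
    have h2 : f i = 0 := Polynomial.ext fun n => key n s f h1 i hi
    apply Subtype.ext
    rw [← hf i, h2, map_zero]
    rfl
  have := hli.finite_of_isNoetherian
  exact Module.Finite.of_basis b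

theorem exists_mem_maximalIdeal_ne_zero (P : Place k F) :
    ∃ t ∈ IsLocalRing.maximalIdeal P.ring, t ≠ 0 := by
  by_contra! h
  refine P.ne_top (top_unique fun x _ => ?_)
  rcases eq_or_ne x 0 with rfl | hx
  · exact P.ring.zero_mem
  rcases P.ring.mem_or_inv_mem x with hm | hm
  · exact hm
  · have hu : IsUnit (⟨x⁻¹, hm⟩ : P.ring) := by
      by_contra hn
      exact hx (inv_eq_zero.1 (congrArg Subtype.val (h _ ((IsLocalRing.mem_maximalIdeal _).2 hn))))
    rw [P.ring.valuation_eq_one_iff, map_inv₀, inv_eq_one] at hu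
    exact P.ring.mem_of_valuation_le_one x hu.le

theorem finite_residueField (P : Place k F) (hF : IsFunctionField k F) :
    Module.Finite k P.ResidueField := by
  obtain ⟨t, ht, h0⟩ := P.exists_mem_maximalIdeal_ne_zero
  have := P.finite_quotient_span hF h0 ht
  have hle : Ideal.span {t} ≤ IsLocalRing.maximalIdeal P.ring :=
    (Ideal.span_singleton_le_iff_mem _).2 ht
  exact Module.Finite.of_surjective (Ideal.Quotient.factorₐ k hle).toLinearMap
    (Ideal.Quotient.factor_surjective hle)

/-- An ideal which contains `t ≠ 0` is finitely generated, since `𝒪_P / t` is finite over `k`; and a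
Noetherian valuation ring is discrete. -/
theorem isDiscreteValuationRing (P : Place k F) (hF : IsFunctionField k F) :
    IsDiscreteValuationRing P.ring := by
  have hnoeth : IsNoetherianRing P.ring := by
    refine (isNoetherianRing_iff_ideal_fg _).2 fun I => ?_
    by_cases hI : I = ⊥
    · exact hI ▸ Submodule.fg_bot
    by_cases hI' : I = ⊤
    · exact hI' ▸ Ideal.fg_top _
    obtain ⟨t, htI, h0⟩ := Submodule.exists_mem_ne_zero_of_ne_bot hI
    have := P.finite_quotient_span hF h0 (IsLocalRing.le_maximalIdeal hI' htI)
    have : IsNoetherian P.ring (P.ring ⧸ Ideal.span {t}) := isNoetherian_of_tower k inferInstance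
    refine Submodule.fg_of_fg_map_of_fg_inf_ker (Submodule.mkQ (Ideal.span {t}))
      (IsNoetherian.noetherian _) ?_
    rw [Submodule.ker_mkQ, inf_eq_right.2 ((Ideal.span_singleton_le_iff_mem _).2 htI)]
    exact Submodule.fg_span_singleton t
  refine ((IsDiscreteValuationRing.TFAE P.ring ?_).out 0 1).2
    (inferInstance : ValuationRing P.ring)
  rw [IsLocalRing.isField_iff_maximalIdeal_eq]
  obtain ⟨t, ht, h0⟩ := P.exists_mem_maximalIdeal_ne_zero
  exact fun h => h0 (by simpa [h] using ht)

/-! ### The valuation of a place -/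

section Ord

variable {k F : Type*} [Field k] [Field F] [Algebra k F] (P : Place k F)

theorem valuation_pos {x : F} (hx : x ≠ 0) : 0 < P.ring.valuation x :=
  (Valuation.pos_iff _).2 hx

theorem residue_eq_zero_iff (a : P.ring) :
    IsLocalRing.residue P.ring a = 0 ↔ P.ring.valuation (a : F) < 1 :=
  (IsLocalRing.residue_eq_zero_iff a).trans (P.ring.valuation_lt_one_iff a)

theorem residue_eq_residue_iff (a b : P.ring) :
    IsLocalRing.residue P.ring a = IsLocalRing.residue P.ring b ↔
      P.ring.valuation ((a : F) - b) < 1 := by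
  rw [← sub_eq_zero, ← map_sub, residue_eq_zero_iff]
  rfl

theorem vanishes_iff {x : F} : P.Vanishes x ↔ P.ring.valuation x < 1 := by
  constructor
  · rintro ⟨a, rfl, ha⟩
    exact (P.residue_eq_zero_iff a).1 ha
  · intro h
    exact ⟨⟨x, (P.ring.valuation_le_one_iff x).1 h.le⟩, rfl, (P.residue_eq_zero_iff _).2 h⟩

variable {P} in
theorem IsPrimeElement.valuation_lt_one {t : P.ring} (ht : P.IsPrimeElement t) :
    P.ring.valuation (t : F) < 1 :=
  (P.ring.valuation_lt_one_iff t).1 (ht ▸ Ideal.mem_span_singleton_self t)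

variable {P} in
theorem IsPrimeElement.valuation_pos {t : P.ring} (ht : P.IsPrimeElement t) :
    0 < P.ring.valuation (t : F) :=
  P.valuation_pos fun h => ht.ne_zero (Subtype.ext h)

variable {P} in
theorem IsPrimeElement.ord_eq_one {t : P.ring} (ht : P.IsPrimeElement t) : P.ord (t : F) = 1 := by
  simpa using P.ord_eq ht 1 1

variable [IsDiscreteValuationRing P.ring]

theorem exists_isPrimeElement : ∃ t : P.ring, P.IsPrimeElement t := by
  obtain ⟨t, ht⟩ := IsDiscreteValuationRing.exists_irreducible P.ring
  exact ⟨t, ht.maximalIdeal_eq⟩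

variable {P}

theorem IsPrimeElement.irreducible {t : P.ring} (ht : P.IsPrimeElement t) : Irreducible t :=
  (IsDiscreteValuationRing.irreducible_iff_uniformizer t).2 ht

theorem IsPrimeElement.exists_eq_zpow_mul {t : P.ring} (ht : P.IsPrimeElement t) {x : F}
    (hx : x ≠ 0) : ∃ (n : ℤ) (u : P.ringˣ), x = (t : F) ^ n * ((u : P.ring) : F) := by
  have key : ∀ y : P.ring, y ≠ 0 → ∃ (n : ℕ) (u : P.ringˣ), (y : F) = (t : F) ^ n * (u : P.ring) :=
    fun y hy => by
      obtain ⟨n, u, hu⟩ := IsDiscreteValuationRing.eq_unit_mul_pow_irreducible hy ht.irreducible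
      exact ⟨n, u, by rw [hu]; push_cast; ring⟩
  rcases P.ring.mem_or_inv_mem x with h | h
  · obtain ⟨n, u, hu⟩ := key ⟨x, h⟩ fun h0 => hx (congrArg Subtype.val h0)
    exact ⟨n, u, by simpa using hu⟩
  · obtain ⟨n, u, hu⟩ := key ⟨x⁻¹, h⟩ fun h0 => hx (inv_eq_zero.1 (congrArg Subtype.val h0))
    refine ⟨-n, u⁻¹, ?_⟩
    have hu' : (((u⁻¹ : P.ringˣ) : P.ring) : F) = (((u : P.ring) : F))⁻¹ := by
      refine eq_inv_of_mul_eq_one_left ?_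
      exact congrArg Subtype.val u.inv_mul
    rw [hu', zpow_neg, zpow_natCast, ← mul_inv, ← inv_inv x]
    exact congrArg _ hu

theorem IsPrimeElement.valuation_eq_zpow_ord {t : P.ring} (ht : P.IsPrimeElement t) {x : F}
    (hx : x ≠ 0) : P.ring.valuation x = P.ring.valuation (t : F) ^ P.ord x := by
  obtain ⟨n, u, rfl⟩ := ht.exists_eq_zpow_mul hx
  rw [P.ord_eq ht, map_mul, map_zpow₀, P.ring.valuation_unit, mul_one]

variable (P)

theorem valuation_lt_iff_ord_lt {x y : F} (hx : x ≠ 0) (hy : y ≠ 0) :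
    P.ring.valuation x < P.ring.valuation y ↔ P.ord y < P.ord x := by
  obtain ⟨t, ht⟩ := P.exists_isPrimeElement
  rw [ht.valuation_eq_zpow_ord hx, ht.valuation_eq_zpow_ord hy]
  exact zpow_lt_zpow_iff_right_of_lt_one₀ ht.valuation_pos ht.valuation_lt_one

theorem valuation_eq_iff_ord_eq {x y : F} (hx : x ≠ 0) (hy : y ≠ 0) :
    P.ring.valuation x = P.ring.valuation y ↔ P.ord x = P.ord y := by
  have h1 := P.valuation_lt_iff_ord_lt hx hy
  have h2 := P.valuation_lt_iff_ord_lt hy hx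
  constructor
  · intro h
    rw [h] at h1 h2
    have h3 := h1.not.1 (lt_irrefl _)
    have h4 := h2.not.1 (lt_irrefl _)
    omega
  · intro h
    rw [h] at h1 h2
    exact le_antisymm (not_lt.1 (h2.not.2 (lt_irrefl _))) (not_lt.1 (h1.not.2 (lt_irrefl _)))

theorem ord_mul {x y : F} (hx : x ≠ 0) (hy : y ≠ 0) : P.ord (x * y) = P.ord x + P.ord y := by
  obtain ⟨t, ht⟩ := P.exists_isPrimeElement
  have h := map_mul P.ring.valuation x y
  rw [ht.valuation_eq_zpow_ord hx, ht.valuation_eq_zpow_ord hy,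
    ht.valuation_eq_zpow_ord (mul_ne_zero hx hy), ← zpow_add₀ ht.valuation_pos.ne'] at h
  exact zpow_right_injective₀ ht.valuation_pos ht.valuation_lt_one.ne h

theorem ord_one : P.ord 1 = 0 := by
  have h := P.ord_mul (one_ne_zero (α := F)) one_ne_zero
  rw [one_mul] at h
  omega

theorem ord_pow {x : F} (hx : x ≠ 0) (n : ℕ) : P.ord (x ^ n) = n * P.ord x := by
  induction n with
  | zero => simp [ord_one]
  | succ n ih =>
    rw [pow_succ, P.ord_mul (pow_ne_zero n hx) hx, ih]
    push_cast
    ring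

theorem ord_pos_iff {x : F} (hx : x ≠ 0) : 0 < P.ord x ↔ P.ring.valuation x < 1 := by
  rw [← P.ord_one, ← P.valuation_lt_iff_ord_lt hx one_ne_zero, map_one]

theorem ord_neg_iff {x : F} (hx : x ≠ 0) : P.ord x < 0 ↔ 1 < P.ring.valuation x := by
  rw [← P.ord_one, ← P.valuation_lt_iff_ord_lt one_ne_zero hx, map_one]

theorem ord_zero : P.ord 0 = 0 := by
  obtain ⟨t, ht⟩ := P.exists_isPrimeElement
  rw [ord, dif_neg]
  rintro ⟨n, t, u, ht, h⟩
  rcases mul_eq_zero.1 h.symm with h | h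
  · exact ht.ne_zero (Subtype.ext (eq_zero_of_zpow_eq_zero h))
  · exact u.ne_zero (Subtype.ext h)

end Ord

/-! ### Places lying over a place -/

section LiesOver

variable {k F L : Type*} [Field k] [Field F] [Algebra k F] [Field L] [Algebra k L] [Algebra F L]
  {P : Place k F} {P' : Place k L}

theorem ext_ring {P Q : Place k F} (h : P.ring = Q.ring) : P = Q := by
  cases P; cases Q; congr

theorem LiesOver.algebraMap_mem_iff (h : P'.LiesOver P) {x : F} :
    algebraMap F L x ∈ P'.ring ↔ x ∈ P.ring := by
  rw [← h]; rfl

theorem LiesOver.valuation_le_iff (h : P'.LiesOver P) {x y : F} :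
    P'.ring.valuation (algebraMap F L x) ≤ P'.ring.valuation (algebraMap F L y) ↔
      P.ring.valuation x ≤ P.ring.valuation y := by
  rcases eq_or_ne y 0 with rfl | hy
  · simp
  have hy' : algebraMap F L y ≠ 0 := by simpa using hy
  rw [← div_le_one₀ (P'.valuation_pos hy'), ← div_le_one₀ (P.valuation_pos hy), ← map_div₀,
    ← map_div₀, ← map_div₀, ValuationSubring.valuation_le_one_iff,
    ValuationSubring.valuation_le_one_iff, h.algebraMap_mem_iff]

theorem LiesOver.valuation_lt_iff (h : P'.LiesOver P) {x y : F} :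
    P'.ring.valuation (algebraMap F L x) < P'.ring.valuation (algebraMap F L y) ↔
      P.ring.valuation x < P.ring.valuation y := by
  simpa only [not_le] using h.valuation_le_iff.not

theorem LiesOver.valuation_lt_one_iff (h : P'.LiesOver P) {x : F} :
    P'.ring.valuation (algebraMap F L x) < 1 ↔ P.ring.valuation x < 1 := by
  simpa using h.valuation_lt_iff (x := x) (y := 1)

theorem LiesOver.valuation_le_one_iff (h : P'.LiesOver P) {x : F} :
    P'.ring.valuation (algebraMap F L x) ≤ 1 ↔ P.ring.valuation x ≤ 1 := by
  simpa using h.valuation_le_iff (x := x) (y := 1)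

theorem LiesOver.valuation_eq_iff (h : P'.LiesOver P) {x y : F} :
    P'.ring.valuation (algebraMap F L x) = P'.ring.valuation (algebraMap F L y) ↔
      P.ring.valuation x = P.ring.valuation y := by
  rw [le_antisymm_iff, le_antisymm_iff, h.valuation_le_iff, h.valuation_le_iff]

/-- It is enough that `𝒪_{P'}` dominates `𝒪_P`, as valuation rings are maximal under domination. -/
theorem liesOver_of_forall (h1 : ∀ x ∈ P.ring, algebraMap F L x ∈ P'.ring)
    (h2 : ∀ x, P.ring.valuation x < 1 → P'.ring.valuation (algebraMap F L x) < 1) :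
    P'.LiesOver P := by
  refine ValuationSubring.ext _ _ fun x => ⟨fun hx => ?_, h1 x⟩
  by_contra hn
  have h3 : 1 < P.ring.valuation x := by rwa [← not_le, ValuationSubring.valuation_le_one_iff]
  have h4 := h2 x⁻¹ (by rw [map_inv₀]; exact inv_lt_one_of_one_lt₀ h3)
  rw [map_inv₀, map_inv₀, inv_lt_one_iff₀] at h4
  rcases h4 with h4 | h4
  · have : x = 0 := by simpa using h4
    exact hn (this ▸ P.ring.zero_mem)
  · exact not_le.2 h4 ((P'.ring.valuation_le_one_iff _).2 hx)

/-- A proper ideal of a subring of `L` lying above `𝒪_P` which contains the maximal ideal of `P`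
is cut out by some place of `L` over `P`. -/
theorem exists_liesOver_of_ideal [IsScalarTower k F L] (P : Place k F) (B : Subring L)
    (hB : ∀ a ∈ P.ring, algebraMap F L a ∈ B) (I : Ideal B) (hI : I ≠ ⊤)
    (hPI : ∀ a : F, ∀ ha : a ∈ P.ring, P.ring.valuation a < 1 → ⟨algebraMap F L a, hB a ha⟩ ∈ I) :
    ∃ R : Place k L, R.LiesOver P ∧ B ≤ R.ring.toSubring ∧
      ∀ b ∈ I, R.ring.valuation (b : L) < 1 := by
  obtain ⟨V, hBV, hIV⟩ := I.image_subset_nonunits_valuationSubring hI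
  have hIV' : ∀ b ∈ I, V.valuation (b : L) < 1 := fun b hb =>
    V.mem_nonunits_iff.1 (hIV ⟨b, hb, rfl⟩)
  have hm : ∀ x, P.ring.valuation x < 1 → V.valuation (algebraMap F L x) < 1 := fun x hx =>
    hIV' _ (hPI x ((P.ring.valuation_le_one_iff x).1 hx.le) hx)
  obtain ⟨t, ht, h0⟩ := P.exists_mem_maximalIdeal_ne_zero
  refine ⟨⟨V, fun c => ?_, ?_⟩, liesOver_of_forall (fun x hx => hBV (hB x hx)) hm, hBV, hIV'⟩
  · rw [IsScalarTower.algebraMap_apply k F L]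
    exact hBV (hB _ (P.algebraMap_mem c))
  · intro hV
    have h1 := hm t ((P.ring.valuation_lt_one_iff t).1 ht)
    have h2 : (algebraMap F L t)⁻¹ ∈ V := hV ▸ ValuationSubring.mem_top _
    rw [← V.valuation_le_one_iff, map_inv₀, inv_le_one₀] at h2
    · exact absurd h1 (not_lt.2 h2)
    · rw [Valuation.pos_iff]
      simpa using fun h => h0 (Subtype.ext h)

theorem exists_liesOver [IsScalarTower k F L] (P : Place k F) :
    ∃ R : Place k L, R.LiesOver P := by
  let f : P.ring →+* L := (algebraMap F L).comp P.ring.subtype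
  let e : P.ring ≃+* f.range := RingEquiv.ofLeftInverse (Function.leftInverse_invFun
    ((algebraMap F L).injective.comp Subtype.val_injective : Function.Injective f))
  have hI : ∀ (a : F) (ha : a ∈ P.ring), P.ring.valuation a < 1 →
      (⟨algebraMap F L a, ⟨⟨a, ha⟩, rfl⟩⟩ : f.range) ∈
        (IsLocalRing.maximalIdeal P.ring).comap e.symm.toRingHom := fun a ha hlt => by
    have : (⟨algebraMap F L a, ⟨⟨a, ha⟩, rfl⟩⟩ : f.range) = e ⟨a, ha⟩ := rfl
    rw [this, Ideal.mem_comap]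
    change e.symm (e ⟨a, ha⟩) ∈ _
    rw [e.symm_apply_apply]
    exact (P.ring.valuation_lt_one_iff _).2 hlt
  obtain ⟨R, hR, -⟩ := P.exists_liesOver_of_ideal (L := L) f.range (fun a ha => ⟨⟨a, ha⟩, rfl⟩) _
    (Ideal.comap_ne_top _ (IsLocalRing.maximalIdeal.isMaximal _).ne_top) hI
  exact ⟨R, hR⟩

/-- The restriction to `F` of a place of an algebraic extension `L` of `F`. -/
def restrict (F : Type*) [Field F] [Algebra k F] [Algebra F L] [IsScalarTower k F L]
    [Algebra.IsAlgebraic F L] (R : Place k L) : Place k F where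
  ring := R.ring.comap (algebraMap F L)
  algebraMap_mem c := by
    rw [ValuationSubring.mem_comap, ← IsScalarTower.algebraMap_apply]
    exact R.algebraMap_mem c
  ne_top h := by
    refine R.ne_top (top_unique fun x _ => ?_)
    have hF : ∀ y : F, algebraMap F L y ∈ R.ring := fun y =>
      (ValuationSubring.mem_comap (f := algebraMap F L)).1 (h ▸ ValuationSubring.mem_top y)
    let := ((algebraMap F L).codRestrict R.ring hF).toAlgebra
    have : IsScalarTower F R.ring L := IsScalarTower.of_algebraMap_eq fun _ => rfl
    have hx : IsIntegral R.ring x := (Algebra.IsIntegral.isIntegral (R := F) x).tower_top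
    obtain ⟨y, hy⟩ := IsIntegrallyClosed.isIntegral_iff.1 hx
    rw [← hy]
    exact y.2

theorem liesOver_restrict [IsScalarTower k F L] [Algebra.IsAlgebraic F L] (R : Place k L) :
    R.LiesOver (R.restrict F) := rfl

theorem LiesOver.eq_restrict [IsScalarTower k F L] [Algebra.IsAlgebraic F L]
    (h : P'.LiesOver P) : P = P'.restrict F := ext_ring h.symm

theorem LiesOver.trans {M : Type*} [Field M] [Algebra k M] [Algebra F M] [Algebra L M]
    [IsScalarTower F L M] {R : Place k M} (h : R.LiesOver P') (h' : P'.LiesOver P) :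
    R.LiesOver P := by
  refine ValuationSubring.ext _ _ fun x => ?_
  rw [← h'.algebraMap_mem_iff (L := L), ← h.algebraMap_mem_iff (L := M),
    ← IsScalarTower.algebraMap_apply]
  rfl

/-- If `R` lies over the place `P` of `F`, then so does its restriction to an intermediate field. -/
theorem LiesOver.of_tower {M : Type*} [Field M] [Algebra k M] [Algebra F M] [Algebra L M]
    [IsScalarTower F L M] {R : Place k M} (h : R.LiesOver P') (h' : R.LiesOver P) :
    P'.LiesOver P := by
  refine ValuationSubring.ext _ _ fun x => ?_
  rw [← h'.algebraMap_mem_iff (L := M), IsScalarTower.algebraMap_apply F L M,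
    h.algebraMap_mem_iff]
  rfl

theorem LiesOver.exists_ramificationIdx [IsDiscreteValuationRing P.ring]
    [IsDiscreteValuationRing P'.ring] (h : P'.LiesOver P) :
    ∃ e : ℕ, ∀ x : F, P'.ord (algebraMap F L x) = e * P.ord x := by
  obtain ⟨t, ht⟩ := P.exists_isPrimeElement
  have ht0 : (t : F) ≠ 0 := fun h0 => ht.ne_zero (Subtype.ext h0)
  have ht0' : algebraMap F L t ≠ 0 := by simpa using ht0
  obtain ⟨s, hs⟩ := P'.exists_isPrimeElement
  have hpos := (P'.ord_pos_iff ht0').2 (h.valuation_lt_one_iff.2 ht.valuation_lt_one)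
  refine ⟨(P'.ord (algebraMap F L t)).toNat, fun x => ?_⟩
  rw [Int.toNat_of_nonneg hpos.le]
  rcases eq_or_ne x 0 with rfl | hx
  · simp [ord_zero]
  have hx' : algebraMap F L x ≠ 0 := by simpa using hx
  have h1 : P.ring.valuation x = P.ring.valuation ((t : F) ^ P.ord x) := by
    rw [ht.valuation_eq_zpow_ord hx, map_zpow₀]
  rw [← h.valuation_eq_iff, map_zpow₀, map_zpow₀, hs.valuation_eq_zpow_ord hx',
    hs.valuation_eq_zpow_ord ht0', ← zpow_mul] at h1
  exact zpow_right_injective₀ hs.valuation_pos hs.valuation_lt_one.ne h1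

theorem LiesOver.ord_algebraMap [IsDiscreteValuationRing P.ring]
    [IsDiscreteValuationRing P'.ring] (h : P'.LiesOver P) (x : F) :
    P'.ord (algebraMap F L x) = P'.ramificationIdx P * P.ord x := by
  have h1 := h.exists_ramificationIdx
  rw [ramificationIdx, dif_pos h1]
  exact h1.choose_spec x

end LiesOver

/-! ### Total ramification at a pole of order prime to the degree -/

section Integral

variable {k K L : Type*} [Field k] [Field K] [Field L] [Algebra k K] [Algebra k L] [Algebra K L]

theorem integralAt_iff_mem_lifts {Q : Place k K} {f : K[X]} :
    Q.IntegralAt f ↔ f ∈ Polynomial.lifts (algebraMap Q.ring K) := by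
  rw [Polynomial.lifts_iff_coeff_lifts]
  refine forall_congr' fun n => ⟨fun h => ⟨⟨_, h⟩, rfl⟩, ?_⟩
  rintro ⟨a, ha⟩
  rw [← ha]
  exact a.2

theorem integralAt_prod {Q : Place k K} {ι : Type*} {s : Finset ι} {p : ι → K[X]}
    (h : ∀ i ∈ s, Q.IntegralAt (p i)) : Q.IntegralAt (∏ i ∈ s, p i) :=
  integralAt_iff_mem_lifts.2 (prod_mem fun i hi => integralAt_iff_mem_lifts.1 (h i hi))

theorem LiesOver.integralAt_map {Q : Place k K} {R : Place k L} (h : R.LiesOver Q) {f : K[X]}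
    (hf : Q.IntegralAt f) : R.IntegralAt (f.map (algebraMap K L)) := fun j => by
  rw [coeff_map, h.algebraMap_mem_iff]
  exact hf j

end Integral

theorem exists_valuation_sub_algebraMap_lt_one {k K : Type*} [Field k] [Field K] [Algebra k K]
    {Q : Place k K} (hQ : Q.deg = 1) {x : K} (hx : x ∈ Q.ring) :
    ∃ c : k, Q.ring.valuation (x - algebraMap k K c) < 1 := by
  have h := Algebra.surjective_algebraMap_iff.2
    (Subalgebra.bot_eq_top_of_finrank_eq_one (F := k) (E := Q.ResidueField) hQ).symm
  obtain ⟨c, hc⟩ := h (IsLocalRing.residue Q.ring ⟨x, hx⟩)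
  exact ⟨c, (Q.residue_eq_residue_iff _ (algebraMap k Q.ring c)).1 hc.symm⟩

section Generation

variable {k K L : Type*} [Field k] [Field K] [Field L] [Algebra k K] [Algebra K L]
  {Q : Place k K} [IsDiscreteValuationRing Q.ring] {g : K[X]} {α : K} {z : L}

theorem ne_zero_of_ord_neg {x : K}
    (h : Q.ord x < 0) : x ≠ 0 := by
  rintro rfl
  simp [Q.ord_zero] at h

theorem one_lt_valuation_of_ord_neg {x : K}
    (h : Q.ord x < 0) : 1 < Q.ring.valuation x :=
  (Q.ord_neg_iff (ne_zero_of_ord_neg h)).1 h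

theorem natDegree_pos_of_ord_neg (hg : g.Monic) (hα : Q.ord α < 0)
    (hz : aeval z g = algebraMap K L α) : 0 < g.natDegree := by
  by_contra! h
  rw [hg.natDegree_eq_zero.1 (by omega), map_one] at hz
  have : α = 1 := (algebraMap K L).injective (by rw [← hz, map_one])
  rw [this, Q.ord_one] at hα
  exact lt_irrefl _ hα

theorem exists_aeval_eq_of_ord_neg (hg : g.Monic) (hα : Q.ord α < 0)
    (hz : aeval z g = algebraMap K L α) (hL : IntermediateField.adjoin K {z} = ⊤) (x : L) :
    ∃ f : K[X], f.natDegree < g.natDegree ∧ aeval z f = x := by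
  have hpos := natDegree_pos_of_ord_neg hg hα hz
  have hmon : (g - C α).Monic := hg.sub_of_left (by
    refine degree_C_le.trans_lt ?_
    rwa [← natDegree_pos_iff_degree_pos])
  have hroot : aeval z (g - C α) = 0 := by simp [hz]
  have hint : IsIntegral K z := ⟨_, hmon, by rwa [← aeval_def]⟩
  have hx : x ∈ (IntermediateField.adjoin K {z}).toSubalgebra := by rw [hL]; trivial
  rw [IntermediateField.adjoin_simple_toSubalgebra_of_isAlgebraic hint.isAlgebraic,
    Algebra.adjoin_singleton_eq_range_aeval] at hx
  obtain ⟨f, rfl⟩ := hx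
  refine ⟨f %ₘ (g - C α), ?_, ?_⟩
  · have h := natDegree_modByMonic_lt f hmon (fun h => by
      have := congrArg natDegree h
      rw [natDegree_sub_C, natDegree_one] at this
      omega)
    rwa [natDegree_sub_C] at h
  · exact aeval_modByMonic_eq_self_of_root hroot

end Generation

section Pole

variable {k K L : Type*} [Field k] [Field K] [Field L] [Algebra k K] [Algebra k L] [Algebra K L]
  {Q : Place k K} {R : Place k L} {g : K[X]} {α : K} {z : L}

/-- As `g(z) = α` has a pole at `R`, so has `z`; then the leading term of `g(z)` dominates. -/
theorem LiesOver.valuation_pow_natDegree (hR : R.LiesOver Q) (hg : g.Monic) (hgQ : Q.IntegralAt g)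
    (hα : 1 < Q.ring.valuation α) (hz : aeval z g = algebraMap K L α) :
    R.ring.valuation z ^ g.natDegree = R.ring.valuation (algebraMap K L α) := by
  have hc : ∀ j, R.ring.valuation (algebraMap K L (g.coeff j)) ≤ 1 := fun j =>
    hR.valuation_le_one_iff.2 ((Q.ring.valuation_le_one_iff _).2 (hgQ j))
  rw [aeval_eq_sum_range] at hz
  simp only [Algebra.smul_def] at hz
  have hα' : 1 < R.ring.valuation (algebraMap K L α) := by
    rw [← not_le, hR.valuation_le_one_iff, not_le]
    exact hα
  have hz1 : 1 < R.ring.valuation z := by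
    by_contra! hz1
    refine not_le.2 hα' ?_
    rw [← hz]
    refine R.ring.valuation.map_sum_le fun j _ => ?_
    rw [map_mul, map_pow]
    exact mul_le_one' (hc j) (pow_le_one' hz1 j)
  rw [← hz, R.ring.valuation.map_sum_eq_of_lt (Finset.self_mem_range_succ g.natDegree)]
  · rw [hg.coeff_natDegree, map_one, one_mul, map_pow]
  · intro j hj
    rw [hg.coeff_natDegree, map_one, one_mul, map_mul, map_pow, map_pow]
    simp only [Finset.mem_sdiff, Finset.mem_range, Finset.mem_singleton] at hj
    exact (mul_le_of_le_one_left' (hc j)).trans_lt (pow_lt_pow_right₀ hz1 (by omega))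

theorem LiesOver.valuation_mul_pow_pow (hR : R.LiesOver Q) (hg : g.Monic) (hgQ : Q.IntegralAt g)
    (hα : 1 < Q.ring.valuation α) (hz : aeval z g = algebraMap K L α) (c : K) (j : ℕ) :
    R.ring.valuation (algebraMap K L c * z ^ j) ^ g.natDegree =
      R.ring.valuation (algebraMap K L (c ^ g.natDegree * α ^ j)) := by
  simp only [map_mul, map_pow, mul_pow]
  rw [← hR.valuation_pow_natDegree hg hgQ hα hz, ← pow_mul, ← pow_mul, mul_comm j]

variable [IsDiscreteValuationRing Q.ring]

/-- The orders of the `m`-th powers of these terms are `m * ord c + i * ord α` up to the factor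
`e(R|Q)`, so `i` is determined modulo `m`. -/
theorem LiesOver.eq_of_valuation_mul_pow_eq (hR : R.LiesOver Q) (hg : g.Monic)
    (hgQ : Q.IntegralAt g) (hα : Q.ord α < 0) (hz : aeval z g = algebraMap K L α)
    (hcop : Int.gcd (Q.ord α) g.natDegree = 1) {c d : K} (hc : c ≠ 0) (hd : d ≠ 0) {i j : ℕ}
    (hi : i < g.natDegree) (hj : j < g.natDegree)
    (h : R.ring.valuation (algebraMap K L c * z ^ i) =
      R.ring.valuation (algebraMap K L d * z ^ j)) : i = j := by
  have hα0 := ne_zero_of_ord_neg hα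
  have hα1 := one_lt_valuation_of_ord_neg hα
  have h1 := congrArg (· ^ g.natDegree) h
  simp only [hR.valuation_mul_pow_pow hg hgQ hα1 hz] at h1
  rw [hR.valuation_eq_iff, Q.valuation_eq_iff_ord_eq
    (mul_ne_zero (pow_ne_zero _ hc) (pow_ne_zero _ hα0))
    (mul_ne_zero (pow_ne_zero _ hd) (pow_ne_zero _ hα0)),
    Q.ord_mul (pow_ne_zero _ hc) (pow_ne_zero _ hα0),
    Q.ord_mul (pow_ne_zero _ hd) (pow_ne_zero _ hα0), Q.ord_pow hc, Q.ord_pow hd, Q.ord_pow hα0,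
    Q.ord_pow hα0] at h1
  have h2 : (g.natDegree : ℤ) ∣ Q.ord α * ((i : ℤ) - j) :=
    ⟨Q.ord d - Q.ord c, by linear_combination h1⟩
  have h3 : (g.natDegree : ℤ) ∣ (i : ℤ) - j :=
    Int.dvd_of_dvd_mul_right_of_gcd_one h2 (by rwa [Int.gcd_comm])
  have h4 := Int.eq_zero_of_abs_lt_dvd h3 (by rw [abs_lt]; omega)
  omega

/-- The terms of `f(z)` have distinct valuations, so one of them dominates. -/
theorem LiesOver.exists_valuation_aeval_eq (hR : R.LiesOver Q) (hg : g.Monic)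
    (hgQ : Q.IntegralAt g) (hα : Q.ord α < 0) (hz : aeval z g = algebraMap K L α)
    (hcop : Int.gcd (Q.ord α) g.natDegree = 1) {f : K[X]} (hf : f ≠ 0)
    (hdeg : f.natDegree < g.natDegree) :
    ∃ j ∈ f.support, R.ring.valuation (aeval z f) =
        R.ring.valuation (algebraMap K L (f.coeff j) * z ^ j) ∧
      ∀ i, R.ring.valuation (algebraMap K L (f.coeff i) * z ^ i) ≤
        R.ring.valuation (aeval z f) := by
  obtain ⟨j, hj, hmax⟩ := f.support.exists_max_image
    (fun i => R.ring.valuation (algebraMap K L (f.coeff i) * z ^ i))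
    (by simpa [Finset.nonempty_iff_ne_empty] using hf)
  have hlt : ∀ i ∈ f.support, i < g.natDegree := fun i hi =>
    (le_natDegree_of_mem_supp i hi).trans_lt hdeg
  have heq : R.ring.valuation (aeval z f) =
      R.ring.valuation (algebraMap K L (f.coeff j) * z ^ j) := by
    rw [aeval_def, eval₂_eq_sum, Polynomial.sum]
    refine R.ring.valuation.map_sum_eq_of_lt hj fun i hi => ?_
    rw [Finset.mem_sdiff, Finset.mem_singleton] at hi
    refine lt_of_le_of_ne (hmax i hi.1) fun h => hi.2 ?_
    exact hR.eq_of_valuation_mul_pow_eq hg hgQ hα hz hcop (mem_support_iff.1 hi.1)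
      (mem_support_iff.1 hj) (hlt i hi.1) (hlt j hj) h
  refine ⟨j, hj, heq, fun i => ?_⟩
  by_cases hi : i ∈ f.support
  · exact heq ▸ hmax i hi
  · simp [notMem_support_iff.1 hi]

end Pole

section TotallyRamified

variable {k K L : Type*} [Field k] [Field K] [Field L] [Algebra k K] [Algebra k L] [Algebra K L]
  {Q : Place k K} [IsDiscreteValuationRing Q.ring] {g : K[X]} {α : K} {z : L}

theorem eq_zero_of_aeval_eq_zero_of_ord_neg [IsScalarTower k K L]
    (hg : g.Monic) (hgQ : Q.IntegralAt g) (hα : Q.ord α < 0)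
    (hz : aeval z g = algebraMap K L α) (hcop : Int.gcd (Q.ord α) g.natDegree = 1)
    {f : K[X]} (hdeg : f.natDegree < g.natDegree) (h0 : aeval z f = 0) : f = 0 := by
  by_contra hf
  obtain ⟨R, hR⟩ := Q.exists_liesOver (L := L)
  obtain ⟨j, hj, h, -⟩ := hR.exists_valuation_aeval_eq hg hgQ hα hz hcop hf hdeg
  have h1 := hR.valuation_mul_pow_pow hg hgQ (one_lt_valuation_of_ord_neg hα) hz (f.coeff j) j
  rw [← h, h0, map_zero, zero_pow (natDegree_pos_of_ord_neg hg hα hz).ne', eq_comm] at h1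
  simp [ne_zero_of_ord_neg hα, mem_support_iff.1 hj] at h1

theorem minpoly_eq_of_ord_neg [IsScalarTower k K L]
    (hg : g.Monic) (hgQ : Q.IntegralAt g) (hα : Q.ord α < 0)
    (hz : aeval z g = algebraMap K L α) (hcop : Int.gcd (Q.ord α) g.natDegree = 1) :
    minpoly K z = g - C α := by
  have hpos := natDegree_pos_of_ord_neg hg hα hz
  have hmon : (g - C α).Monic := hg.sub_of_left (by
    refine degree_C_le.trans_lt ?_
    rwa [← natDegree_pos_iff_degree_pos])
  have hroot : aeval z (g - C α) = 0 := by simp [hz]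
  refine (minpoly.unique K z hmon hroot fun q hq hq0 => ?_).symm
  by_contra! hlt
  have hlt' := natDegree_lt_natDegree hq.ne_zero hlt
  rw [natDegree_sub_C] at hlt'
  exact hq.ne_zero (eq_zero_of_aeval_eq_zero_of_ord_neg hg hgQ hα hz hcop hlt' hq0)

theorem finrank_eq_of_ord_neg [IsScalarTower k K L]
    (hg : g.Monic) (hgQ : Q.IntegralAt g) (hα : Q.ord α < 0)
    (hz : aeval z g = algebraMap K L α) (hcop : Int.gcd (Q.ord α) g.natDegree = 1)
    (hL : IntermediateField.adjoin K {z} = ⊤) : Module.finrank K L = g.natDegree := by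
  have hmin := minpoly_eq_of_ord_neg hg hgQ hα hz hcop
  have hint : IsIntegral K z := by
    by_contra h
    rw [minpoly.eq_zero h] at hmin
    have := congrArg natDegree hmin
    rw [natDegree_sub_C, natDegree_zero] at this
    exact (natDegree_pos_of_ord_neg hg hα hz).ne this
  have h := IntermediateField.adjoin.finrank hint
  rwa [hL, IntermediateField.finrank_top', hmin, natDegree_sub_C] at h

/-- The condition on the right does not mention `R`: this gives the uniqueness of the place over
`Q`. -/
theorem LiesOver.mem_ring_iff_of_ord_neg {R : Place k L} (hR : R.LiesOver Q) (hg : g.Monic)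
    (hgQ : Q.IntegralAt g) (hα : Q.ord α < 0) (hz : aeval z g = algebraMap K L α)
    (hcop : Int.gcd (Q.ord α) g.natDegree = 1) {f : K[X]} (hdeg : f.natDegree < g.natDegree) :
    aeval z f ∈ R.ring ↔ ∀ j, f.coeff j ^ g.natDegree * α ^ j ∈ Q.ring := by
  have hterm : ∀ j, R.ring.valuation (algebraMap K L (f.coeff j) * z ^ j) ≤ 1 ↔
      f.coeff j ^ g.natDegree * α ^ j ∈ Q.ring := fun j => by
    rw [← hR.algebraMap_mem_iff, ← ValuationSubring.valuation_le_one_iff,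
      ← hR.valuation_mul_pow_pow hg hgQ (one_lt_valuation_of_ord_neg hα) hz,
      pow_le_one_iff (natDegree_pos_of_ord_neg hg hα hz).ne']
  simp only [← hterm]
  rcases eq_or_ne f 0 with rfl | hf
  · simp [R.ring.zero_mem]
  obtain ⟨j, -, h1, h2⟩ := hR.exists_valuation_aeval_eq hg hgQ hα hz hcop hf hdeg
  rw [← ValuationSubring.valuation_le_one_iff]
  exact ⟨fun h i => (h2 i).trans h, fun h => h1 ▸ h j⟩

theorem LiesOver.eq_of_ord_neg {R R' : Place k L} (hR : R.LiesOver Q) (hR' : R'.LiesOver Q)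
    (hg : g.Monic) (hgQ : Q.IntegralAt g) (hα : Q.ord α < 0)
    (hz : aeval z g = algebraMap K L α) (hcop : Int.gcd (Q.ord α) g.natDegree = 1)
    (hL : IntermediateField.adjoin K {z} = ⊤) : R = R' := by
  refine ext_ring (ValuationSubring.ext _ _ fun x => ?_)
  obtain ⟨f, hdeg, rfl⟩ := exists_aeval_eq_of_ord_neg hg hα hz hL x
  rw [hR.mem_ring_iff_of_ord_neg hg hgQ hα hz hcop hdeg,
    hR'.mem_ring_iff_of_ord_neg hg hgQ hα hz hcop hdeg]

/-- With `e = e(R|Q)`, the relation `m * ord_R z = e * ord_Q α` gives `m ∣ e`, and the `m`-th power of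
a prime element of `R` has the same value as some element of `K`, whence `e ∣ m`. -/
theorem LiesOver.ramificationIdx_eq_of_ord_neg {R : Place k L} [IsDiscreteValuationRing R.ring]
    (hR : R.LiesOver Q) (hg : g.Monic) (hgQ : Q.IntegralAt g) (hα : Q.ord α < 0)
    (hz : aeval z g = algebraMap K L α) (hcop : Int.gcd (Q.ord α) g.natDegree = 1)
    (hL : IntermediateField.adjoin K {z} = ⊤) : R.ramificationIdx Q = g.natDegree := by
  have hα0 := ne_zero_of_ord_neg hα
  have hα1 := one_lt_valuation_of_ord_neg hα
  have hα0' : algebraMap K L α ≠ 0 := by simpa using hα0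
  have hz0 : z ≠ 0 := by
    rintro rfl
    have h := hR.valuation_pow_natDegree hg hgQ hα1 hz
    rw [map_zero, zero_pow (natDegree_pos_of_ord_neg hg hα hz).ne'] at h
    exact (R.valuation_pos hα0').ne h
  refine Nat.dvd_antisymm ?_ ?_
  · obtain ⟨w, hw⟩ := R.exists_isPrimeElement
    have hw0 : (w : L) ≠ 0 := fun h => hw.ne_zero (Subtype.ext h)
    obtain ⟨f, hdeg, hf⟩ := exists_aeval_eq_of_ord_neg hg hα hz hL (w : L)
    have hf0 : f ≠ 0 := by
      rintro rfl
      exact hw0 (by rw [← hf, map_zero])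
    obtain ⟨j, hj, h, -⟩ := hR.exists_valuation_aeval_eq hg hgQ hα hz hcop hf0 hdeg
    have h1 := hR.valuation_mul_pow_pow hg hgQ hα1 hz (f.coeff j) j
    have hne : f.coeff j ^ g.natDegree * α ^ j ≠ 0 :=
      mul_ne_zero (pow_ne_zero _ (mem_support_iff.1 hj)) (pow_ne_zero _ hα0)
    rw [← h, hf, ← map_pow, R.valuation_eq_iff_ord_eq (pow_ne_zero _ hw0) (by simpa using hne),
      R.ord_pow hw0, hw.ord_eq_one, hR.ord_algebraMap, mul_one] at h1
    exact_mod_cast Dvd.intro _ h1.symm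
  · have h := hR.valuation_pow_natDegree hg hgQ hα1 hz
    rw [← map_pow, R.valuation_eq_iff_ord_eq (pow_ne_zero _ hz0) hα0', R.ord_pow hz0,
      hR.ord_algebraMap] at h
    have h2 : (g.natDegree : ℤ) ∣ R.ramificationIdx Q := by
      refine Int.dvd_of_dvd_mul_left_of_gcd_one ⟨_, h.symm⟩ (by rwa [Int.gcd_comm])
    exact_mod_cast h2

theorem totallyRamified_of_ord_neg [IsScalarTower k K L]
    [∀ R : Place k L, IsDiscreteValuationRing R.ring]
    (hg : g.Monic) (hgQ : Q.IntegralAt g) (hα : Q.ord α < 0)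
    (hz : aeval z g = algebraMap K L α) (hcop : Int.gcd (Q.ord α) g.natDegree = 1)
    (hL : IntermediateField.adjoin K {z} = ⊤) : Q.TotallyRamified L := by
  obtain ⟨R, hR⟩ := Q.exists_liesOver (L := L)
  refine ⟨R, fun R' => ⟨fun h => h.eq_of_ord_neg hR hg hgQ hα hz hcop hL, fun h => h ▸ hR⟩, ?_⟩
  rw [hR.ramificationIdx_eq_of_ord_neg hg hgQ hα hz hcop hL,
    finrank_eq_of_ord_neg hg hgQ hα hz hcop hL]

/-- The constant term is the only term of an element of `𝒪_R` which can be a unit at `R`, and modulo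
the rational place `Q` it is congruent to some `c ∈ k`. A constant `x` is thus equal to `c`, because
nonzero constants are units at `R`. -/
theorem mem_range_algebraMap_of_isAlgebraic_of_ord_neg [IsScalarTower k K L]
    (hQ : Q.deg = 1) (hg : g.Monic)
    (hgQ : Q.IntegralAt g) (hα : Q.ord α < 0) (hz : aeval z g = algebraMap K L α)
    (hcop : Int.gcd (Q.ord α) g.natDegree = 1) (hL : IntermediateField.adjoin K {z} = ⊤)
    {x : L} (hx : IsAlgebraic k x) : x ∈ (algebraMap k L).range := by
  obtain ⟨R, hR⟩ := Q.exists_liesOver (L := L)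
  obtain ⟨f, hdeg, rfl⟩ := exists_aeval_eq_of_ord_neg hg hα hz hL x
  rcases eq_or_ne f 0 with rfl | hf
  · exact ⟨0, by simp⟩
  have hxR := (R.ring.valuation_le_one_iff _).2 (R.mem_ring_of_isAlgebraic hx)
  obtain ⟨-, -, -, hle⟩ := hR.exists_valuation_aeval_eq hg hgQ hα hz hcop hf hdeg
  have hle1 : ∀ i, R.ring.valuation (algebraMap K L (f.coeff i) * z ^ i) ≤ 1 := fun i =>
    (hle i).trans hxR
  have hlt : R.ring.valuation (aeval z f - algebraMap K L (f.coeff 0)) < 1 := by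
    rw [aeval_eq_sum_range, Finset.sum_range_succ', pow_zero]
    simp only [Algebra.smul_def, mul_one, add_sub_cancel_right]
    refine R.ring.valuation.map_sum_lt one_ne_zero fun i hi => lt_of_le_of_ne (hle1 _) fun h => ?_
    have hi' := Finset.mem_range.1 hi
    have hc : f.coeff (i + 1) ≠ 0 := by
      intro h0
      simp [h0] at h
    have := hR.eq_of_valuation_mul_pow_eq hg hgQ hα hz hcop hc one_ne_zero (i := i + 1) (j := 0)
      (by omega) (by omega) (by rw [h]; simp)
    omega
  have h0 : f.coeff 0 ∈ Q.ring := by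
    rw [← hR.algebraMap_mem_iff, ← ValuationSubring.valuation_le_one_iff]
    simpa using hle1 0
  obtain ⟨c, hc⟩ := exists_valuation_sub_algebraMap_lt_one hQ h0
  rw [← hR.valuation_lt_one_iff, map_sub, ← IsScalarTower.algebraMap_apply] at hc
  refine ⟨c, ?_⟩
  have h1 : R.ring.valuation (aeval z f - algebraMap k L c) < 1 := by
    have := R.ring.valuation.map_add_lt hlt hc
    rwa [sub_add_sub_cancel] at this
  exact (sub_eq_zero.1 (R.eq_zero_of_isAlgebraic (hx.sub (isAlgebraic_algebraMap c)) h1)).symm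

end TotallyRamified

/-! ### Places cut out by an irreducible factor of a polynomial modulo a place -/

section Kummer

variable {k K L : Type*} [Field k] [Field K] [Algebra k K] [Field L] [Algebra K L] (P : Place k K)

/-- Reduction of polynomials modulo `P`. -/
noncomputable def reduction : P.ring[X] →+* P.ResidueField[X] :=
  mapRingHom (IsLocalRing.residue P.ring)

/-- Evaluation at `z ∈ L` of polynomials with coefficients in `𝒪_P`. -/
noncomputable def evalHom (z : L) : P.ring[X] →+* L :=
  eval₂RingHom ((algebraMap K L).comp P.ring.subtype) z

theorem reduction_surjective : Function.Surjective P.reduction :=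
  map_surjective _ IsLocalRing.residue_surjective

theorem reduction_C (a : P.ring) : P.reduction (C a) = C (IsLocalRing.residue P.ring a) :=
  map_C _

theorem evalHom_C (z : L) (a : P.ring) : P.evalHom z (C a) = algebraMap K L a :=
  eval₂_C _ _

theorem evalHom_eq_aeval (z : L) (f : P.ring[X]) :
    P.evalHom z f = aeval z (f.map (algebraMap P.ring K)) := by
  rw [aeval_def, eval₂_map]
  rfl

variable {P}

theorem exists_eq_C_mul_of_reduction_eq_zero {t : P.ring} (ht : P.IsPrimeElement t) {f : P.ring[X]}
    (hf : P.reduction f = 0) : ∃ l, f = C t * l := by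
  refine (C_dvd_iff_dvd_coeff t f).2 fun i => ?_
  rw [← Ideal.mem_span_singleton, ← ht, ← IsLocalRing.residue_eq_zero_iff]
  have h := congrArg (fun g => coeff g i) hf
  simpa [reduction] using h

variable {z : L} {q s : P.ring[X]}

theorem exists_reduction_mul_eq_one (hq : Irreducible (P.reduction q)) {f : P.ring[X]}
    (hf : ¬ P.reduction q ∣ P.reduction f) :
    ∃ a b : P.ring[X], P.reduction (a * f + b * q) = 1 := by
  obtain ⟨b, a, h⟩ := (hq.coprime_iff_not_dvd).2 hf
  obtain ⟨a, rfl⟩ := P.reduction_surjective a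
  obtain ⟨b, rfl⟩ := P.reduction_surjective b
  exact ⟨a, b, by rw [map_add, map_mul, map_mul, add_comm, h]⟩

theorem exists_evalHom_eq_mul (hL : ∀ x : L, ∃ f : K[X], aeval z f = x) (x : L) :
    ∃ (a : P.ring) (f : P.ring[X]), a ≠ 0 ∧ algebraMap K L a * x = P.evalHom z f := by
  obtain ⟨f, rfl⟩ := hL x
  obtain ⟨b, hb, h⟩ := IsLocalization.integerNormalization_spec (nonZeroDivisors P.ring) f
  refine ⟨b, IsLocalization.integerNormalization (nonZeroDivisors P.ring) f,
    nonZeroDivisors.ne_zero hb, ?_⟩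
  rw [evalHom_eq_aeval, h, algebra_compatible_smul K, map_smul, Algebra.smul_def]
  rfl

variable [Algebra k L] {R : Place k L}

theorem LiesOver.evalHom_mem (hR : R.LiesOver P) (hz : z ∈ R.ring) (f : P.ring[X]) :
    P.evalHom z f ∈ R.ring := by
  rw [evalHom, coe_eval₂RingHom, eval₂_eq_sum_range]
  exact sum_mem fun i _ => mul_mem (hR.algebraMap_mem_iff.2 (f.coeff i).2) (pow_mem hz i)

theorem LiesOver.mem_ring_of_evalHom_mem (hR : R.LiesOver P) {f : P.ring[X]} (hf : f.Monic)
    (h0 : P.evalHom z f = 0) : z ∈ R.ring := by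
  let ι : P.ring →+* R.ring := ((algebraMap K L).comp P.ring.subtype).codRestrict R.ring
    fun a => hR.algebraMap_mem_iff.2 a.2
  have h : IsIntegral R.ring z := by
    refine ⟨f.map ι, hf.map ι, ?_⟩
    rw [eval₂_map]
    exact h0
  obtain ⟨y, hy⟩ := IsIntegrallyClosed.isIntegral_iff.1 h
  rw [← hy]
  exact y.2

variable [IsDiscreteValuationRing P.ring]

theorem LiesOver.valuation_evalHom_lt_one_of_reduction_eq_zero (hR : R.LiesOver P)
    (hz : z ∈ R.ring) {f : P.ring[X]} (hf : P.reduction f = 0) :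
    R.ring.valuation (P.evalHom z f) < 1 := by
  obtain ⟨t, ht⟩ := P.exists_isPrimeElement
  obtain ⟨l, rfl⟩ := exists_eq_C_mul_of_reduction_eq_zero ht hf
  rw [map_mul, evalHom_C, map_mul]
  exact mul_lt_one_of_lt_of_le (hR.valuation_lt_one_iff.2 ht.valuation_lt_one)
    ((R.ring.valuation_le_one_iff _).2 (hR.evalHom_mem hz l))

/-- The polynomials whose value at `z` vanishes at `R` are those divisible by `q` modulo `P`. -/
theorem LiesOver.valuation_evalHom_lt_one_iff (hR : R.LiesOver P) (hz : z ∈ R.ring)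
    (hq : Irreducible (P.reduction q)) (hqz : R.ring.valuation (P.evalHom z q) < 1)
    (f : P.ring[X]) :
    R.ring.valuation (P.evalHom z f) < 1 ↔ P.reduction q ∣ P.reduction f := by
  have hle : ∀ f, R.ring.valuation (P.evalHom z f) ≤ 1 := fun f =>
    (R.ring.valuation_le_one_iff _).2 (hR.evalHom_mem hz f)
  constructor
  · intro hf
    by_contra hdvd
    obtain ⟨a, b, hab⟩ := exists_reduction_mul_eq_one hq hdvd
    have h1 : R.ring.valuation (P.evalHom z (a * f + b * q - 1)) < 1 :=
      hR.valuation_evalHom_lt_one_of_reduction_eq_zero hz (by rw [map_sub, hab, map_one, sub_self])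
    have h2 : R.ring.valuation (P.evalHom z (a * f + b * q)) < 1 := by
      rw [map_add, map_mul, map_mul]
      refine R.ring.valuation.map_add_lt ?_ ?_ <;> rw [map_mul]
      · exact (mul_le_of_le_one_left' (hle a)).trans_lt hf
      · exact (mul_le_of_le_one_left' (hle b)).trans_lt hqz
    have h3 := R.ring.valuation.map_sub_lt h2 h1
    rw [← map_sub, sub_sub_cancel, map_one, map_one] at h3
    exact lt_irrefl _ h3
  · rintro ⟨h, hh⟩
    obtain ⟨h, rfl⟩ := P.reduction_surjective h
    have h1 : R.ring.valuation (P.evalHom z (f - q * h)) < 1 :=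
      hR.valuation_evalHom_lt_one_of_reduction_eq_zero hz (by rw [map_sub, map_mul, hh, sub_self])
    have h2 : R.ring.valuation (P.evalHom z (q * h)) < 1 := by
      rw [map_mul, map_mul]
      exact mul_lt_one_of_lt_of_le hqz (hle h)
    have h3 := R.ring.valuation.map_add_lt h1 h2
    rwa [← map_add, sub_add_cancel] at h3

theorem LiesOver.valuation_evalHom_eq_one (hR : R.LiesOver P) (hz : z ∈ R.ring)
    (hq : Irreducible (P.reduction q)) (hqz : R.ring.valuation (P.evalHom z q) < 1)
    {f : P.ring[X]} (hf : ¬ P.reduction q ∣ P.reduction f) :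
    R.ring.valuation (P.evalHom z f) = 1 :=
  le_antisymm ((R.ring.valuation_le_one_iff _).2 (hR.evalHom_mem hz f))
    (not_lt.1 ((hR.valuation_evalHom_lt_one_iff hz hq hqz f).not.2 hf))

/-- The local ring of `𝒪_P[z]` at the maximal ideal `(P, q(z))` has a principal maximal ideal,
generated by a prime element `t` of `P`, because `q(z) s(z) = α` is divisible by `t` and `s(z)` is a
unit there. Hence each nonzero value `f(z)` is a power of `t` times a unit of that ring. -/
theorem LiesOver.exists_evalHom_mul_eq [IsDiscreteValuationRing R.ring] (hR : R.LiesOver P)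
    (hz : z ∈ R.ring) {t : P.ring} (ht : P.IsPrimeElement t) (hq : Irreducible (P.reduction q))
    (hqz : R.ring.valuation (P.evalHom z q) < 1) (hs : ¬ P.reduction q ∣ P.reduction s) {α : K}
    (hα : P.ring.valuation α < 1) (hqs : P.evalHom z (q * s) = algebraMap K L α) {f : P.ring[X]}
    (hf : P.evalHom z f ≠ 0) :
    ∃ (n : ℕ) (u w : P.ring[X]), ¬ P.reduction q ∣ P.reduction u ∧
      ¬ P.reduction q ∣ P.reduction w ∧
      P.evalHom z w * P.evalHom z f = algebraMap K L t ^ n * P.evalHom z u := by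
  have hone : ¬ P.reduction q ∣ P.reduction 1 := by
    rw [map_one]
    exact fun h => hq.not_isUnit (isUnit_of_dvd_one h)
  have ht0 : algebraMap K L t ≠ 0 := by
    simpa using fun h => ht.ne_zero (Subtype.ext h)
  have htord : 0 < R.ord (algebraMap K L t) :=
    (R.ord_pos_iff ht0).2 (hR.valuation_lt_one_iff.2 ht.valuation_lt_one)
  have hsz := hR.valuation_evalHom_eq_one hz hq hqz hs
  have hs0 : P.evalHom z s ≠ 0 := fun h => by simp [h] at hsz
  have hsord : R.ord (P.evalHom z s) = 0 := by
    rw [← R.ord_one, ← R.valuation_eq_iff_ord_eq hs0 one_ne_zero, hsz, map_one]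
  obtain ⟨a, ha⟩ : ∃ a : P.ring, α = t * a := by
    have h : (⟨α, (P.ring.valuation_le_one_iff α).1 hα.le⟩ : P.ring) ∈
        IsLocalRing.maximalIdeal P.ring := (P.ring.valuation_lt_one_iff _).2 hα
    rw [ht, Ideal.mem_span_singleton] at h
    obtain ⟨a, ha⟩ := h
    exact ⟨a, congrArg Subtype.val ha⟩
  induction hN : (R.ord (P.evalHom z f)).toNat using Nat.strong_induction_on generalizing f with
  | _ N ih =>
  by_cases hdvd : P.reduction q ∣ P.reduction f
  · -- `f = q h + t l`, so `s f` takes the value `α h + t s l`, which is divisible by `t`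
    obtain ⟨h, hh⟩ := id hdvd
    obtain ⟨h, rfl⟩ := P.reduction_surjective h
    obtain ⟨l, hl⟩ := exists_eq_C_mul_of_reduction_eq_zero ht (f := f - q * h)
      (by rw [map_sub, map_mul, hh, sub_self])
    have hstep : P.evalHom z s * P.evalHom z f =
        algebraMap K L t * P.evalHom z (C a * h + s * l) := by
      have h1 : s * f = q * s * h + C t * (s * l) := by linear_combination s * hl
      rw [← map_mul, h1, map_add, map_mul, hqs, ha]
      simp only [map_add, map_mul, evalHom_C]
      ring
    have hf' : P.evalHom z (C a * h + s * l) ≠ 0 := fun h0 => by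
      rw [h0, mul_zero] at hstep
      exact (mul_ne_zero hs0 hf) hstep
    have hord := congrArg R.ord hstep
    rw [R.ord_mul hs0 hf, R.ord_mul ht0 hf', hsord] at hord
    have hpos : 0 < R.ord (P.evalHom z f) :=
      (R.ord_pos_iff hf).2 ((hR.valuation_evalHom_lt_one_iff hz hq hqz f).2 hdvd)
    obtain ⟨n, u, w, hu, hw, huw⟩ := ih _ (by omega) hf' rfl
    refine ⟨n + 1, u, w * s, hu, ?_, ?_⟩
    · rw [map_mul]
      exact fun h => (hq.prime.dvd_or_dvd h).elim hw hs
    · rw [map_mul, mul_assoc, hstep, pow_succ, mul_assoc, mul_left_comm, huw]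
      ring
  · exact ⟨0, f, 1, hdvd, hone, by simp⟩

theorem LiesOver.exists_eq_zpow_mul_div [IsDiscreteValuationRing R.ring] (hR : R.LiesOver P)
    (hz : z ∈ R.ring) {t : P.ring} (ht : P.IsPrimeElement t) (hq : Irreducible (P.reduction q))
    (hqz : R.ring.valuation (P.evalHom z q) < 1) (hs : ¬ P.reduction q ∣ P.reduction s) {α : K}
    (hα : P.ring.valuation α < 1) (hqs : P.evalHom z (q * s) = algebraMap K L α)
    (hL : ∀ x : L, ∃ f : K[X], aeval z f = x) {x : L} (hx : x ≠ 0) :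
    ∃ (n : ℤ) (u w : P.ring[X]), ¬ P.reduction q ∣ P.reduction u ∧
      ¬ P.reduction q ∣ P.reduction w ∧
      x = algebraMap K L t ^ n * (P.evalHom z u / P.evalHom z w) := by
  have hne : ∀ f : P.ring[X], ¬ P.reduction q ∣ P.reduction f → P.evalHom z f ≠ 0 :=
    fun f hf h => by simpa [h] using hR.valuation_evalHom_eq_one hz hq hqz hf
  have ht0 : algebraMap K L t ≠ 0 := by
    simpa using fun h => ht.ne_zero (Subtype.ext h)
  obtain ⟨a, f, ha, haf⟩ := exists_evalHom_eq_mul (P := P) hL x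
  have ha0 : P.evalHom z (C a) ≠ 0 := by
    rw [evalHom_C]
    simpa using fun h => ha (Subtype.ext h)
  rw [← evalHom_C (z := z)] at haf
  have hf0 : P.evalHom z f ≠ 0 := haf ▸ mul_ne_zero ha0 hx
  obtain ⟨n₁, u₁, w₁, hu₁, hw₁, h₁⟩ := hR.exists_evalHom_mul_eq hz ht hq hqz hs hα hqs hf0
  obtain ⟨n₂, u₂, w₂, hu₂, hw₂, h₂⟩ := hR.exists_evalHom_mul_eq hz ht hq hqz hs hα hqs ha0
  refine ⟨n₁ - n₂, u₁ * w₂, w₁ * u₂, ?_, ?_, ?_⟩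
  · rw [map_mul]
    exact fun h => (hq.prime.dvd_or_dvd h).elim hu₁ hw₂
  · rw [map_mul]
    exact fun h => (hq.prime.dvd_or_dvd h).elim hw₁ hu₂
  · have := hne _ hu₁
    rw [zpow_sub₀ ht0, zpow_natCast, zpow_natCast, map_mul, map_mul]
    rw [div_mul_div_comm,
      eq_div_iff (mul_ne_zero (pow_ne_zero _ ht0) (mul_ne_zero (hne _ hw₁) (hne _ hu₂)))]
    linear_combination (-(x * P.evalHom z w₁)) * h₂ + P.evalHom z w₁ * P.evalHom z w₂ * haf +
      P.evalHom z w₂ * h₁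

end Kummer

section KummerPlaces

variable {k K L : Type*} [Field k] [Field K] [Algebra k K] [Field L] [Algebra K L] [Algebra k L]
  {P : Place k K} {z : L} {q s : P.ring[X]}

/-- The ideal generated by `P` and `q(z)` in `𝒪_P[z]` is proper, because `q` divides the minimal
polynomial `q s - α` of `z` modulo `P`; a place which contains it exists. -/
theorem exists_liesOver_valuation_evalHom_lt_one [IsScalarTower k K L]
    (hq : Irreducible (P.reduction q)) {α : P.ring} (hα : IsLocalRing.residue P.ring α = 0)
    (hmon : (q * s - C α).Monic)
    (hmin : minpoly K z = (q * s - C α).map (algebraMap P.ring K)) :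
    ∃ R : Place k L, R.LiesOver P ∧ R.ring.valuation (P.evalHom z q) < 1 := by
  let J : Ideal P.ring[X] := (Ideal.span {P.reduction q}).comap P.reduction
  have hJ : ∀ f, f ∈ J ↔ P.reduction q ∣ P.reduction f := fun f => by
    rw [Ideal.mem_comap, Ideal.mem_span_singleton]
  have hsurj := (P.evalHom z).rangeRestrict_surjective
  have hI : J.map (P.evalHom z).rangeRestrict ≠ ⊤ := by
    rw [Ideal.ne_top_iff_one, Ideal.mem_map_iff_of_surjective _ hsurj]
    rintro ⟨f, hf, h1⟩
    have h2 : P.evalHom z (f - 1) = 0 := by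
      rw [map_sub, map_one, sub_eq_zero]
      exact congrArg Subtype.val h1
    rw [evalHom_eq_aeval, ← minpoly.dvd_iff, hmin, map_dvd_map _ Subtype.val_injective hmon] at h2
    have h3 : P.reduction q ∣ P.reduction (f - 1) := by
      refine dvd_trans ?_ (map_dvd P.reduction h2)
      rw [map_sub, reduction_C, hα, map_zero, sub_zero, map_mul]
      exact dvd_mul_right _ _
    rw [map_sub, map_one] at h3
    exact hq.not_isUnit (isUnit_of_dvd_one ((dvd_sub_right ((hJ f).1 hf)).1 h3))
  have hC : ∀ a : P.ring, (P.evalHom z).rangeRestrict (C a) =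
      ⟨algebraMap K L a, ⟨C a, P.evalHom_C z a⟩⟩ := fun a => Subtype.ext (P.evalHom_C z a)
  obtain ⟨R, hR, -, hlt⟩ := P.exists_liesOver_of_ideal (L := L) (P.evalHom z).range
    (fun a ha => ⟨C ⟨a, ha⟩, P.evalHom_C z ⟨a, ha⟩⟩) _ hI fun a ha hv => by
      rw [← hC ⟨a, ha⟩]
      refine Ideal.mem_map_of_mem _ ((hJ _).2 ?_)
      rw [reduction_C, (P.residue_eq_zero_iff _).2 hv, map_zero]
      exact dvd_zero _
  exact ⟨R, hR, hlt _ (Ideal.mem_map_of_mem _ ((hJ q).2 dvd_rfl))⟩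

variable [IsDiscreteValuationRing P.ring] {R : Place k L}

theorem LiesOver.mem_ring_iff_zpow [IsDiscreteValuationRing R.ring] (hR : R.LiesOver P)
    (hz : z ∈ R.ring) {t : P.ring} (ht : P.IsPrimeElement t) (hq : Irreducible (P.reduction q))
    (hqz : R.ring.valuation (P.evalHom z q) < 1) {u w : P.ring[X]}
    (hu : ¬ P.reduction q ∣ P.reduction u) (hw : ¬ P.reduction q ∣ P.reduction w) (n : ℤ) :
    algebraMap K L t ^ n * (P.evalHom z u / P.evalHom z w) ∈ R.ring ↔ 0 ≤ n := by
  have ht0 : 0 < R.ring.valuation (algebraMap K L t) := R.valuation_pos (by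
    simpa using fun h => ht.ne_zero (Subtype.ext h))
  have ht1 := hR.valuation_lt_one_iff.2 ht.valuation_lt_one
  rw [← ValuationSubring.valuation_le_one_iff, map_mul, map_div₀, map_zpow₀,
    hR.valuation_evalHom_eq_one hz hq hqz hu, hR.valuation_evalHom_eq_one hz hq hqz hw, div_one,
    mul_one]
  exact zpow_le_one_iff_right_of_lt_one₀ ht0 ht1

theorem LiesOver.eq_of_valuation_evalHom_lt_one {R' : Place k L} [IsDiscreteValuationRing R.ring]
    [IsDiscreteValuationRing R'.ring] (hR : R.LiesOver P) (hR' : R'.LiesOver P)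
    (hz : z ∈ R.ring) (hz' : z ∈ R'.ring) (hq : Irreducible (P.reduction q))
    (hqz : R.ring.valuation (P.evalHom z q) < 1) (hqz' : R'.ring.valuation (P.evalHom z q) < 1)
    (hs : ¬ P.reduction q ∣ P.reduction s) {α : K}
    (hα : P.ring.valuation α < 1) (hqs : P.evalHom z (q * s) = algebraMap K L α)
    (hL : ∀ x : L, ∃ f : K[X], aeval z f = x) : R = R' := by
  obtain ⟨t, ht⟩ := P.exists_isPrimeElement
  refine ext_ring (ValuationSubring.ext _ _ fun x => ?_)
  rcases eq_or_ne x 0 with rfl | hx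
  · simp [zero_mem]
  obtain ⟨n, u, w, hu, hw, rfl⟩ := hR.exists_eq_zpow_mul_div hz ht hq hqz hs hα hqs hL hx
  rw [hR.mem_ring_iff_zpow hz ht hq hqz hu hw, hR'.mem_ring_iff_zpow hz' ht hq hqz' hu hw]

/-- Every residue class at `R` is represented by a polynomial value. -/
theorem LiesOver.exists_valuation_sub_evalHom_lt_one [IsDiscreteValuationRing R.ring]
    (hR : R.LiesOver P) (hz : z ∈ R.ring) (hq : Irreducible (P.reduction q))
    (hqz : R.ring.valuation (P.evalHom z q) < 1) (hs : ¬ P.reduction q ∣ P.reduction s) {α : K}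
    (hα : P.ring.valuation α < 1) (hqs : P.evalHom z (q * s) = algebraMap K L α)
    (hL : ∀ x : L, ∃ f : K[X], aeval z f = x) {x : L} (hx : x ∈ R.ring) :
    ∃ f : P.ring[X], R.ring.valuation (P.evalHom z f - x) < 1 := by
  obtain ⟨t, ht⟩ := P.exists_isPrimeElement
  rcases eq_or_ne x 0 with rfl | hx0
  · exact ⟨0, by simp⟩
  obtain ⟨n, u, w, hu, hw, rfl⟩ := hR.exists_eq_zpow_mul_div hz ht hq hqz hs hα hqs hL hx0
  rw [hR.mem_ring_iff_zpow hz ht hq hqz hu hw] at hx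
  have hv := hR.valuation_evalHom_eq_one hz hq hqz hu
  have hv' := hR.valuation_evalHom_eq_one hz hq hqz hw
  rcases hx.eq_or_lt with rfl | hn
  · obtain ⟨a, b, hab⟩ := exists_reduction_mul_eq_one hq hw
    refine ⟨u * a, ?_⟩
    have h1 : R.ring.valuation (P.evalHom z (a * w - 1)) < 1 := by
      rw [hR.valuation_evalHom_lt_one_iff hz hq hqz, map_sub, map_one]
      refine ⟨-P.reduction b, ?_⟩
      rw [map_add, map_mul, map_mul] at hab
      rw [map_mul]
      linear_combination hab
    have hw0 : P.evalHom z w ≠ 0 := fun h => by simp [h] at hv'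
    have h2 : P.evalHom z (u * a) - algebraMap K L t ^ (0 : ℤ) * (P.evalHom z u / P.evalHom z w) =
        P.evalHom z u / P.evalHom z w * P.evalHom z (a * w - 1) := by
      rw [map_mul, map_sub, map_mul, map_one, zpow_zero]
      field_simp
    rwa [h2, map_mul, map_div₀, hv, hv', div_one, one_mul]
  · refine ⟨0, ?_⟩
    have ht1 := hR.valuation_lt_one_iff.2 ht.valuation_lt_one
    rw [map_zero, zero_sub, Valuation.map_neg, map_mul, map_div₀, hv, hv', div_one, mul_one,
      map_zpow₀]
    have ht0 : 0 < R.ring.valuation (algebraMap K L t) := R.valuation_pos (by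
      simpa using fun h => ht.ne_zero (Subtype.ext h))
    exact (zpow_lt_one_iff_right_of_lt_one₀ ht0 ht1).2 hn

theorem LiesOver.deg_eq_of_valuation_evalHom_lt_one [IsScalarTower k K L]
    [IsDiscreteValuationRing R.ring]
    (hR : R.LiesOver P) (hz : z ∈ R.ring) (hq : Irreducible (P.reduction q))
    (hqz : R.ring.valuation (P.evalHom z q) < 1) (hs : ¬ P.reduction q ∣ P.reduction s) {α : K}
    (hα : P.ring.valuation α < 1) (hqs : P.evalHom z (q * s) = algebraMap K L α)
    (hL : ∀ x : L, ∃ f : K[X], aeval z f = x) :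
    R.deg = (P.reduction q).natDegree * P.deg := by
  let ε : P.ring[X] →ₐ[k] R.ring :=
    { (P.evalHom z).codRestrict R.ring (hR.evalHom_mem hz) with
      commutes' := fun c => Subtype.ext (by
        change P.evalHom z (algebraMap k P.ring[X] c) = algebraMap k L c
        rw [IsScalarTower.algebraMap_apply k P.ring P.ring[X], algebraMap_eq, evalHom_C,
          IsScalarTower.algebraMap_apply k K L]
        rfl) }
  let ρ : P.ring[X] →ₐ[k] R.ResidueField :=
    (IsScalarTower.toAlgHom k R.ring R.ResidueField).comp ε
  have hρ : Function.Surjective ρ := fun y => by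
    obtain ⟨y, rfl⟩ := IsLocalRing.residue_surjective y
    obtain ⟨f, hf⟩ := hR.exists_valuation_sub_evalHom_lt_one hz hq hqz hs hα hqs hL y.2
    exact ⟨f, (R.residue_eq_residue_iff _ _).2 hf⟩
  let σ : P.ring[X] →ₐ[k] AdjoinRoot (P.reduction q) :=
    { (AdjoinRoot.mk (P.reduction q)).comp P.reduction with
      commutes' := fun c => by
        change AdjoinRoot.mk (P.reduction q) (P.reduction (algebraMap k P.ring[X] c)) = _
        rw [IsScalarTower.algebraMap_apply k P.ring P.ring[X], algebraMap_eq, reduction_C,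
          AdjoinRoot.mk_C]
        rfl }
  have hσ : Function.Surjective σ := AdjoinRoot.mk_surjective.comp P.reduction_surjective
  have hker : RingHom.ker ρ = RingHom.ker σ := by
    ext f
    rw [RingHom.mem_ker, RingHom.mem_ker]
    exact ((R.residue_eq_zero_iff _).trans (hR.valuation_evalHom_lt_one_iff hz hq hqz f)).trans
      AdjoinRoot.mk_eq_zero.symm
  have e : R.ResidueField ≃ₐ[k] AdjoinRoot (P.reduction q) :=
    (Ideal.quotientKerAlgEquivOfSurjective hρ).symm.trans
      ((Ideal.quotientEquivAlgOfEq k hker).trans (Ideal.quotientKerAlgEquivOfSurjective hσ))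
  have : Fact (Irreducible (P.reduction q)) := ⟨hq⟩
  rw [deg, e.toLinearEquiv.finrank_eq, ← Module.finrank_mul_finrank k P.ResidueField,
    (AdjoinRoot.powerBasis hq.ne_zero).finrank, AdjoinRoot.powerBasis_dim, mul_comm]
  rfl

end KummerPlaces

/-! ### Weak approximation and completely split places -/

section Approximation

variable {k L : Type*} [Field k] [Field L] [Algebra k L]

theorem eq_of_ring_le {R R' : Place k L} [IsDiscreteValuationRing R.ring] (h : R.ring ≤ R'.ring) :
    R = R' := by
  have : Ring.KrullDimLE 1 R.ring := inferInstance
  exact ext_ring (ValuationSubring.eq_of_le_of_ne_top R.ring h R'.ne_top)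

theorem exists_valuation_lt_one_and_one_lt {R R' : Place k L} [IsDiscreteValuationRing R.ring]
    [IsDiscreteValuationRing R'.ring] (h : R ≠ R') :
    ∃ u : L, R.ring.valuation u < 1 ∧ 1 < R'.ring.valuation u := by
  obtain ⟨a, ha, ha'⟩ := SetLike.not_le_iff_exists.1 fun hle => h (eq_of_ring_le hle)
  obtain ⟨b, hb, hb'⟩ := SetLike.not_le_iff_exists.1 fun hle => h (eq_of_ring_le hle).symm
  rw [← ValuationSubring.valuation_le_one_iff] at ha ha' hb hb'
  rw [not_le] at ha' hb'
  refine ⟨a / b, ?_, ?_⟩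
  · rw [map_div₀, div_lt_one₀ (zero_lt_one.trans hb')]
    exact ha.trans_lt hb'
  · have hb0 : b ≠ 0 := by
      rintro rfl
      simp at hb'
    rw [map_div₀, one_lt_div₀ (R'.valuation_pos hb0)]
    exact hb.trans_lt ha'

/-- In the induction step `y` is replaced by `y + w ^ n`, where `w` has a zero at `R` and a pole at
the new place, and `n > 0` is such that no cancellation can occur at the old places. -/
theorem exists_valuation_lt_one_and_forall_one_lt [∀ R : Place k L, IsDiscreteValuationRing R.ring]
    (R : Place k L) (T : Finset (Place k L)) (hRT : R ∉ T) :
    ∃ u : L, R.ring.valuation u < 1 ∧ ∀ R' ∈ T, 1 < R'.ring.valuation u := by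
  classical
  induction T using Finset.induction_on with
  | empty => exact ⟨0, by simp, by simp⟩
  | insert r T hr ih =>
    rw [Finset.mem_insert, not_or] at hRT
    obtain ⟨y, hy, hyT⟩ := ih hRT.2
    by_cases hry : 1 < r.ring.valuation y
    · exact ⟨y, hy, Finset.forall_mem_insert .. |>.2 ⟨hry, hyT⟩⟩
    rw [not_lt] at hry
    obtain ⟨w, hw, hwr⟩ := exists_valuation_lt_one_and_one_lt hRT.1
    have hbad : {n : ℕ | ∃ R' ∈ T, R'.ring.valuation w ^ n = R'.ring.valuation y}.Finite := by
      have : {n : ℕ | ∃ R' ∈ T, R'.ring.valuation w ^ n = R'.ring.valuation y} =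
          ⋃ R' ∈ T, {n : ℕ | R'.ring.valuation w ^ n = R'.ring.valuation y} := by
        ext n; simp
      rw [this]
      refine T.finite_toSet.biUnion fun R' hR' => Set.Subsingleton.finite fun n hn n' hn' => ?_
      have h1 : 1 < R'.ring.valuation w := by
        by_contra! hle
        exact not_le.2 (hyT R' hR') (hn ▸ pow_le_one' hle n)
      exact pow_right_injective₀ (zero_lt_one.trans h1) h1.ne' (hn.trans hn'.symm)
    obtain ⟨n, hn⟩ := (hbad.insert 0).exists_notMem
    rw [Set.mem_insert_iff, not_or] at hn
    obtain ⟨hn0, hn⟩ := hn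
    refine ⟨y + w ^ n, ?_, Finset.forall_mem_insert .. |>.2 ⟨?_, fun R' hR' => ?_⟩⟩
    · refine R.ring.valuation.map_add_lt hy ?_
      rw [map_pow]
      exact pow_lt_one' hw hn0
    · have h1 : 1 < r.ring.valuation (w ^ n) := by
        rw [map_pow]
        exact one_lt_pow' hwr hn0
      rwa [Valuation.map_add_eq_of_lt_right _ (hry.trans_lt h1)]
    · rw [Valuation.map_add_of_distinct_val]
      · exact lt_max_of_lt_left (hyT R' hR')
      · rw [map_pow]
        exact fun h => hn ⟨R', hR', h.symm⟩

theorem exists_forall_valuation_lt_pow (R : Place k L) [IsDiscreteValuationRing R.ring] {u : L}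
    (hu : 1 < R.ring.valuation u) (y : L) :
    ∃ n : ℕ, ∀ n' ≥ n, R.ring.valuation y < R.ring.valuation u ^ n' := by
  have hu0 : u ≠ 0 := by
    rintro rfl
    simp at hu
  rcases eq_or_ne y 0 with rfl | hy
  · exact ⟨0, fun n _ => by rw [map_zero]; exact pow_pos (zero_lt_one.trans hu) n⟩
  have h1 := (R.ord_neg_iff hu0).2 hu
  refine ⟨(R.ord y).natAbs + 1, fun n hn => ?_⟩
  rw [← map_pow, R.valuation_lt_iff_ord_lt hy (pow_ne_zero _ hu0), R.ord_pow hu0]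
  have h2 : (n : ℤ) ≥ (R.ord y).natAbs + 1 := by exact_mod_cast hn
  have h3 := neg_abs_le (R.ord y)
  rw [Int.natCast_natAbs] at h2
  nlinarith

/-- Weak approximation of an element `y` at `R` and of `0` at the places in `T`. -/
theorem exists_valuation_sub_lt_one_and_forall_lt_one
    [∀ R : Place k L, IsDiscreteValuationRing R.ring] (R : Place k L) (T : Finset (Place k L))
    (hRT : R ∉ T) {y : L} (hy : y ∈ R.ring) :
    ∃ x : L, R.ring.valuation (x - y) < 1 ∧ ∀ R' ∈ T, R'.ring.valuation x < 1 := by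
  obtain ⟨u, hu, huT⟩ := exists_valuation_lt_one_and_forall_one_lt R T hRT
  choose! n hn using fun (R' : Place k L) (hR' : R' ∈ T) =>
    R'.exists_forall_valuation_lt_pow (huT R' hR') y
  -- `1 / (1 + u ^ s)` is congruent to `1` at `R`, and has a zero of large order at the places in `T`
  let s := T.sup n + 1
  have hus : R.ring.valuation (u ^ s) < 1 := by
    rw [map_pow]
    exact pow_lt_one' hu (Nat.succ_ne_zero _)
  have h1 : R.ring.valuation (1 + u ^ s) = 1 := Valuation.map_one_add_of_lt _ hus
  have h0 : 1 + u ^ s ≠ 0 := fun h => by simp [h] at h1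
  refine ⟨y / (1 + u ^ s), ?_, fun R' hR' => ?_⟩
  · have : y / (1 + u ^ s) - y = -(y * u ^ s / (1 + u ^ s)) := by
      field_simp
      ring
    rw [this, Valuation.map_neg, map_div₀, h1, div_one, map_mul]
    exact (mul_le_of_le_one_left' ((R.ring.valuation_le_one_iff y).2 hy)).trans_lt hus
  · have h2 : 1 < R'.ring.valuation (u ^ s) := by
      rw [map_pow]
      exact one_lt_pow' (huT R' hR') (Nat.succ_ne_zero _)
    have h3 : R'.ring.valuation (1 + u ^ s) = R'.ring.valuation u ^ s := by
      rw [Valuation.map_add_eq_of_lt_right _ (by rwa [map_one]), map_pow]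
    rw [map_div₀, h3, div_lt_one₀ (pow_pos (zero_lt_one.trans (huT R' hR')) _)]
    exact hn R' hR' s ((Finset.le_sup hR').trans (Nat.le_succ _))

end Approximation

section SplitsCompletely

variable {k K L : Type*} [Field k] [Field K] [Algebra k K] [Field L] [Algebra K L] [Algebra k L]

/-- If there are `[L : K]` places of `L` over `P`, then each of them has the same residue class
field as `P`: otherwise weak approximation gives `[L : K] + 1` elements which are linearly
independent over `K`, namely one idempotent modulo the places for each place over `P`, and a lift
of a residue class that does not come from `P`. -/
theorem SplitsCompletely.exists_valuation_sub_algebraMap_lt_one [FiniteDimensional K L]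
    [∀ R : Place k L, IsDiscreteValuationRing R.ring] {P : Place k K} (hP : P.SplitsCompletely L)
    {P' : Place k L} (hP' : P'.LiesOver P) {y : L} (hy : y ∈ P'.ring) :
    ∃ x ∈ P.ring, P'.ring.valuation (y - algebraMap K L x) < 1 := by
  classical
  by_contra! hno
  have hfin : {R : Place k L | R.LiesOver P}.Finite :=
    Set.finite_of_ncard_pos (hP ▸ Module.finrank_pos)
  let T := hfin.toFinset
  have hT : ∀ {R}, R ∈ T ↔ R.LiesOver P := by simp [T]
  have hP'T := hT.2 hP'
  have happ : ∀ R : Place k L, ∀ y ∈ R.ring, ∃ x : L, R.ring.valuation (x - y) < 1 ∧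
      ∀ R' ∈ T, R' ≠ R → R'.ring.valuation x < 1 := fun R y hy => by
    obtain ⟨x, h1, h2⟩ :=
      exists_valuation_sub_lt_one_and_forall_lt_one R (T.erase R) (by simp) hy
    exact ⟨x, h1, fun R' hR' hne => h2 R' (Finset.mem_erase.2 ⟨hne, hR'⟩)⟩
  choose w hw hw' using fun R : Place k L => happ R 1 R.ring.one_mem
  obtain ⟨v, hv, hv'⟩ := happ P' y hy
  let b : Option T → L := fun o => o.elim v fun R => w R
  suffices hli : LinearIndependent K b by
    have h := hli.fintype_card_le_finrank
    rw [Fintype.card_option, Fintype.card_coe, ← hP, Set.ncard_eq_toFinset_card _ hfin] at h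
    exact absurd h (by simp [T])
  rw [Fintype.linearIndependent_iff]
  by_contra! hdep
  obtain ⟨c, hc, i, hi⟩ := hdep
  obtain ⟨j, -, hj⟩ := Finset.univ.exists_max_image (fun i => P.ring.valuation (c i))
    ⟨i, Finset.mem_univ i⟩
  have hj0 : c j ≠ 0 := by
    intro h0
    have := hj i (Finset.mem_univ i)
    rw [h0, map_zero, le_zero_iff, map_eq_zero] at this
    exact hi this
  let d : Option T → K := fun i => c i / c j
  have hd : ∀ i, P.ring.valuation (d i) ≤ 1 := fun i => by
    rw [map_div₀, div_le_one₀ (P.valuation_pos hj0)]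
    exact hj i (Finset.mem_univ i)
  have hsum : algebraMap K L (d none) * v + ∑ R : T, algebraMap K L (d (some R)) * w R = 0 := by
    have h := congrArg (algebraMap K L (c j)⁻¹ * ·) hc
    simp only [Fintype.sum_option, Algebra.smul_def, mul_zero, mul_add, Finset.mul_sum,
      ← mul_assoc, ← map_mul] at h
    rw [← h]
    simp only [d, b, div_eq_inv_mul]
    rfl
  -- modulo a place `R`, all terms of the relation vanish except those of `R` itself
  have hloc : ∀ R : T, R.1.ring.valuation
      (algebraMap K L (d none) * v + algebraMap K L (d (some R))) < 1 := fun R => by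
    have hle : ∀ i, R.1.ring.valuation (algebraMap K L (d i)) ≤ 1 := fun i =>
      (hT.1 R.2).valuation_le_one_iff.2 (hd i)
    have h1 : R.1.ring.valuation (∑ S ∈ Finset.univ.erase R,
        algebraMap K L (d (some S)) * w S) < 1 := by
      refine R.1.ring.valuation.map_sum_lt one_ne_zero fun S hS => ?_
      rw [map_mul]
      refine (mul_le_of_le_one_left' (hle _)).trans_lt (hw' S R R.2 fun h => ?_)
      exact (Finset.mem_erase.1 hS).1 (Subtype.ext h.symm)
    have h2 : R.1.ring.valuation (algebraMap K L (d (some R)) * (w R - 1)) < 1 := by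
      rw [map_mul]
      exact (mul_le_of_le_one_left' (hle _)).trans_lt (hw R)
    have h3 := R.1.ring.valuation.map_add_lt h1 h2
    rw [← Valuation.map_neg] at h3
    convert h3 using 2
    rw [← Finset.add_sum_erase _ _ (Finset.mem_univ R)] at hsum
    linear_combination hsum
  have hnone : P.ring.valuation (d none) < 1 := by
    refine lt_of_le_of_ne (hd none) fun h1 => ?_
    have h0 : d none ≠ 0 := fun h => by simp [h] at h1
    have hmem : -(d (some ⟨P', hP'T⟩) / d none) ∈ P.ring := by
      rw [← ValuationSubring.valuation_le_one_iff, Valuation.map_neg, map_div₀, h1, div_one]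
      exact hd _
    refine not_lt.2 (hno _ hmem) ?_
    have h1' : P'.ring.valuation (algebraMap K L (d none)) = 1 := by
      rw [← map_one P'.ring.valuation, ← map_one (algebraMap K L), hP'.valuation_eq_iff, h1,
        map_one]
    have h2 : y - algebraMap K L (-(d (some ⟨P', hP'T⟩) / d none)) =
        (algebraMap K L (d none) * v + algebraMap K L (d (some ⟨P', hP'T⟩))) /
          algebraMap K L (d none) - (v - y) := by
      have : algebraMap K L (d none) ≠ 0 := by simpa using h0
      rw [map_neg, map_div₀]
      field_simp
      ring
    rw [h2]
    refine Valuation.map_sub_lt _ ?_ hv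
    rw [map_div₀, h1', div_one]
    exact hloc ⟨P', hP'T⟩
  have hsome : ∀ R : T, P.ring.valuation (d (some R)) < 1 := fun R => by
    have hR := hT.1 R.2
    have hvle : R.1.ring.valuation v ≤ 1 := by
      by_cases hRP : R.1 = P'
      · rw [hRP, ← sub_add_cancel v y]
        exact Valuation.map_add_le _ hv.le ((P'.ring.valuation_le_one_iff y).2 hy)
      · exact (hv' R R.2 hRP).le
    have h1 : R.1.ring.valuation (algebraMap K L (d none) * v) < 1 := by
      rw [map_mul]
      exact mul_lt_one_of_lt_of_le (hR.valuation_lt_one_iff.2 hnone) hvle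
    have h2 := R.1.ring.valuation.map_sub_lt (hloc R) h1
    rwa [add_sub_cancel_left, hR.valuation_lt_one_iff] at h2
  have hlt : P.ring.valuation (d j) < 1 := by
    cases j with
    | none => exact hnone
    | some R => exact hsome R
  simp [d, hj0] at hlt

/-- Irreducibility modulo `P` persists at a place over `P` with the same residue class field. -/
theorem LiesOver.irreducibleAt_map {P : Place k K} {P' : Place k L} (h : P'.LiesOver P)
    (hres : ∀ y ∈ P'.ring, ∃ x ∈ P.ring, P'.ring.valuation (y - algebraMap K L x) < 1)
    {f : K[X]} (hf : P.IrreducibleAt f) : P'.IrreducibleAt (f.map (algebraMap K L)) := by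
  obtain ⟨g, rfl, hg⟩ := hf
  let ι : P.ring →+* P'.ring := ((algebraMap K L).comp P.ring.subtype).codRestrict P'.ring
    fun a => h.algebraMap_mem_iff.2 a.2
  have hι : ∀ a, IsLocalRing.residue P'.ring (ι a) = 0 ↔ IsLocalRing.residue P.ring a = 0 :=
    fun a => by
      rw [residue_eq_zero_iff, residue_eq_zero_iff]
      exact h.valuation_lt_one_iff
  let φ : P.ResidueField →+* P'.ResidueField :=
    Ideal.Quotient.lift _ ((IsLocalRing.residue P'.ring).comp ι) fun a ha =>
      (hι a).2 (IsLocalRing.residue_eq_zero_iff a |>.2 ha)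
  have hφ : ∀ a, φ (IsLocalRing.residue P.ring a) = IsLocalRing.residue P'.ring (ι a) :=
    fun a => rfl
  have hsurj : Function.Surjective φ := fun y => by
    obtain ⟨y, rfl⟩ := IsLocalRing.residue_surjective y
    obtain ⟨x, hx, hxy⟩ := hres y y.2
    exact ⟨IsLocalRing.residue P.ring ⟨x, hx⟩,
      ((P'.residue_eq_residue_iff y (ι ⟨x, hx⟩)).2 hxy).symm⟩
  let e := RingEquiv.ofBijective φ ⟨φ.injective, hsurj⟩
  refine ⟨g.map ι, ?_, ?_⟩
  · rw [Polynomial.map_map, Polynomial.map_map]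
    rfl
  · have : (g.map ι).map (IsLocalRing.residue P'.ring) =
        Polynomial.mapEquiv e (g.map (IsLocalRing.residue P.ring)) := by
      rw [Polynomial.map_map, Polynomial.mapEquiv_apply, Polynomial.map_map]
      rfl
    rw [this, MulEquiv.irreducible_iff]
    exact hg

end SplitsCompletely

/-! ### Places over a zero of `α` -/

section Family

variable {k K L : Type*} [Field k] [Field K] [Algebra k K] [Field L] [Algebra K L]
  {P : Place k K} {N : Finset ℕ} {p : ℕ → K[X]} {α : K} {z : L}

theorem not_reduction_dvd_prod_erase {q : ℕ → P.ring[X]}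
    (hq : ∀ i ∈ N, (q i).Monic ∧ (q i).natDegree = i)
    (hirr : ∀ i ∈ N, Irreducible (P.reduction (q i))) {i : ℕ} (hi : i ∈ N) :
    ¬ P.reduction (q i) ∣ P.reduction (∏ j ∈ N.erase i, q j) := by
  rw [map_prod, (hirr i hi).prime.dvd_finsetProd_iff]
  rintro ⟨j, hj, hdvd⟩
  obtain ⟨hne, hj⟩ := Finset.mem_erase.1 hj
  have h := eq_of_monic_of_associated ((hq i hi).1.map _) ((hq j hj).1.map _)
    ((hirr i hi).associated_of_dvd (hirr j hj) hdvd)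
  have h1 := congrArg natDegree h
  rw [(hq i hi).1.natDegree_map, (hq j hj).1.natDegree_map, (hq i hi).2, (hq j hj).2] at h1
  exact hne h1.symm

theorem exists_lift_of_irreducibleAt (hp : ∀ i ∈ N, (p i).Monic ∧ (p i).natDegree = i)
    (hirr : ∀ i ∈ N, P.IrreducibleAt (p i)) :
    ∃ q : ℕ → P.ring[X], (∀ i ∈ N, (q i).map (algebraMap P.ring K) = p i) ∧
      (∀ i ∈ N, (q i).Monic ∧ (q i).natDegree = i) ∧
      ∀ i ∈ N, Irreducible (P.reduction (q i)) := by
  choose! q hmap hq using hirr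
  refine ⟨q, hmap, fun i hi => ?_, hq⟩
  have h := hp i hi
  rw [← hmap i hi] at h
  have hinj : Function.Injective (algebraMap P.ring K) := Subtype.val_injective
  exact ⟨monic_of_injective hinj h.1, by rw [← natDegree_map_eq_of_injective hinj, h.2]⟩

theorem prod_sub_C_eq_map {q : ℕ → P.ring[X]}
    (hmap : ∀ i ∈ N, (q i).map (algebraMap P.ring K) = p i) (a : P.ring) :
    (∏ i ∈ N, p i) - C (a : K) = ((∏ i ∈ N, q i) - C a).map (algebraMap P.ring K) := by
  rw [Polynomial.map_sub, Polynomial.map_prod, map_C, Finset.prod_congr rfl hmap]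
  rfl

theorem LiesOver.exists_valuation_aeval_lt_one [Algebra k L] {R : Place k L} (hR : R.LiesOver P)
    (hirr : ∀ i ∈ N, P.IrreducibleAt (p i)) (hα : P.Vanishes α)
    (hz : z ∈ R.ring) (hroot : aeval z (∏ i ∈ N, p i) = algebraMap K L α) :
    ∃ i ∈ N, R.ring.valuation (aeval z (p i)) < 1 := by
  by_contra! h
  have h1 : ∀ i ∈ N, R.ring.valuation (aeval z (p i)) = 1 := fun i hi => by
    obtain ⟨g, hg, -⟩ := hirr i hi
    refine le_antisymm ?_ (h i hi)
    rw [← hg, ← evalHom_eq_aeval]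
    exact (R.ring.valuation_le_one_iff _).2 (hR.evalHom_mem hz g)
  have h2 := hR.valuation_lt_one_iff.2 (P.vanishes_iff.1 hα)
  rw [← hroot, map_prod, map_prod, Finset.prod_eq_one h1] at h2
  exact lt_irrefl _ h2

variable [FiniteDimensional K L]

theorem exists_aeval_eq (hL : IntermediateField.adjoin K {z} = ⊤) (x : L) :
    ∃ f : K[X], aeval z f = x := by
  have hx : x ∈ (IntermediateField.adjoin K {z}).toSubalgebra := by rw [hL]; trivial
  rwa [IntermediateField.adjoin_simple_toSubalgebra_of_isAlgebraic
    (Algebra.IsAlgebraic.isAlgebraic z), Algebra.adjoin_singleton_eq_range_aeval] at hx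

/-- The polynomial `φ` over `𝒪_P` with its factorization modulo `P`. -/
theorem exists_factorization (hp : ∀ i ∈ N, (p i).Monic ∧ (p i).natDegree = i)
    (hirr : ∀ i ∈ N, P.IrreducibleAt (p i)) (hα : P.Vanishes α)
    (hmin : minpoly K z = (∏ i ∈ N, p i) - C α) {i : ℕ} (hi : i ∈ N) :
    ∃ (q s : P.ring[X]) (a : P.ring), P.evalHom z q = aeval z (p i) ∧
      Irreducible (P.reduction q) ∧ (P.reduction q).natDegree = i ∧
      ¬ P.reduction q ∣ P.reduction s ∧ IsLocalRing.residue P.ring a = 0 ∧ (q * s - C a).Monic ∧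
      minpoly K z = (q * s - C a).map (algebraMap P.ring K) ∧
      P.evalHom z (q * s) = algebraMap K L a := by
  obtain ⟨q, hmap, hq, hred⟩ := exists_lift_of_irreducibleAt hp hirr
  obtain ⟨a, rfl, ha⟩ := hα
  have h1 : minpoly K z = (q i * (∏ j ∈ N.erase i, q j) - C a).map (algebraMap P.ring K) := by
    rw [hmin, Finset.mul_prod_erase N q hi, prod_sub_C_eq_map hmap]
  refine ⟨q i, ∏ j ∈ N.erase i, q j, a, ?_, hred i hi, ?_, not_reduction_dvd_prod_erase hq hred hi,
    ha, ?_, h1, ?_⟩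
  · rw [evalHom_eq_aeval, hmap i hi]
  · exact ((hq i hi).1.natDegree_map _).trans (hq i hi).2
  · refine monic_of_injective (f := algebraMap P.ring K) Subtype.val_injective ?_
    rw [← h1]
    exact minpoly.monic (Algebra.IsIntegral.isIntegral z)
  · have h2 := minpoly.aeval K z
    rw [h1, ← evalHom_eq_aeval, map_sub, evalHom_C, sub_eq_zero] at h2
    exact h2

variable [Algebra k L]

theorem LiesOver.mem_ring_of_minpoly_eq {R : Place k L} (hR : R.LiesOver P)
    (hp : ∀ i ∈ N, (p i).Monic ∧ (p i).natDegree = i)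
    (hirr : ∀ i ∈ N, P.IrreducibleAt (p i)) (hα : P.Vanishes α)
    (hmin : minpoly K z = (∏ i ∈ N, p i) - C α) : z ∈ R.ring := by
  obtain ⟨q, hmap, -, -⟩ := exists_lift_of_irreducibleAt hp hirr
  obtain ⟨a, rfl, -⟩ := hα
  rw [prod_sub_C_eq_map hmap] at hmin
  refine hR.mem_ring_of_evalHom_mem (f := (∏ i ∈ N, q i) - C a)
    (monic_of_injective (f := algebraMap P.ring K) Subtype.val_injective ?_) ?_
  · rw [← hmin]
    exact minpoly.monic (Algebra.IsIntegral.isIntegral z)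
  · rw [evalHom_eq_aeval, ← hmin, minpoly.aeval]

theorem LiesOver.eq_of_valuation_aeval_lt_one [IsDiscreteValuationRing P.ring]
    [∀ R : Place k L, IsDiscreteValuationRing R.ring] {R R' : Place k L} (hR : R.LiesOver P)
    (hR' : R'.LiesOver P) (hp : ∀ i ∈ N, (p i).Monic ∧ (p i).natDegree = i)
    (hirr : ∀ i ∈ N, P.IrreducibleAt (p i)) (hα : P.Vanishes α)
    (hmin : minpoly K z = (∏ i ∈ N, p i) - C α) (hL : IntermediateField.adjoin K {z} = ⊤) {i : ℕ}
    (hi : i ∈ N) (h : R.ring.valuation (aeval z (p i)) < 1)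
    (h' : R'.ring.valuation (aeval z (p i)) < 1) : R = R' := by
  obtain ⟨q, s, a, hqp, hq, -, hs, ha, hmon, hmin', hqs⟩ :=
    exists_factorization hp hirr hα hmin hi
  have h0 : P.evalHom z (q * s - C a) = 0 := by
    rw [evalHom_eq_aeval, ← hmin', minpoly.aeval]
  rw [← hqp] at h h'
  exact hR.eq_of_valuation_evalHom_lt_one hR' (hR.mem_ring_of_evalHom_mem hmon h0)
    (hR'.mem_ring_of_evalHom_mem hmon h0) hq h h' hs ((P.residue_eq_zero_iff a).1 ha) hqs
    (exists_aeval_eq hL)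

variable [IsScalarTower k K L]

theorem exists_liesOver_valuation_aeval_lt_one
    (hp : ∀ i ∈ N, (p i).Monic ∧ (p i).natDegree = i)
    (hirr : ∀ i ∈ N, P.IrreducibleAt (p i)) (hα : P.Vanishes α)
    (hmin : minpoly K z = (∏ i ∈ N, p i) - C α) {i : ℕ} (hi : i ∈ N) :
    ∃ R : Place k L, R.LiesOver P ∧ R.ring.valuation (aeval z (p i)) < 1 := by
  obtain ⟨q, s, a, hqp, hq, -, -, ha, hmon, hmin', -⟩ := exists_factorization hp hirr hα hmin hi
  rw [← hqp]
  exact exists_liesOver_valuation_evalHom_lt_one hq ha hmon hmin'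

variable [IsDiscreteValuationRing P.ring] [∀ R : Place k L, IsDiscreteValuationRing R.ring]

theorem LiesOver.deg_eq_of_valuation_aeval_lt_one {R : Place k L} (hR : R.LiesOver P)
    (hp : ∀ i ∈ N, (p i).Monic ∧ (p i).natDegree = i)
    (hirr : ∀ i ∈ N, P.IrreducibleAt (p i)) (hα : P.Vanishes α)
    (hmin : minpoly K z = (∏ i ∈ N, p i) - C α) (hL : IntermediateField.adjoin K {z} = ⊤) {i : ℕ}
    (hi : i ∈ N) (h : R.ring.valuation (aeval z (p i)) < 1) : R.deg = i * P.deg := by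
  obtain ⟨q, s, a, hqp, hq, hdeg, hs, ha, hmon, hmin', hqs⟩ :=
    exists_factorization hp hirr hα hmin hi
  have h0 : P.evalHom z (q * s - C a) = 0 := by
    rw [evalHom_eq_aeval, ← hmin', minpoly.aeval]
  rw [← hqp] at h
  rw [hR.deg_eq_of_valuation_evalHom_lt_one (hR.mem_ring_of_evalHom_mem hmon h0) hq h hs
    ((P.residue_eq_zero_iff a).1 ha) hqs (exists_aeval_eq hL), hdeg]

end Family

/-! ### Separability -/

/-- A product of monic irreducible polynomials of distinct degrees over the perfect residue class
field is separable; hence `φ' ≠ 0`, as this holds modulo `P`. -/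
theorem separable_prod_sub_C {k K : Type*} [Field k] [Finite k] [Field K] [Algebra k K]
    {P : Place k K} (hfin : Module.Finite k P.ResidueField) {N : Finset ℕ} {p : ℕ → K[X]} {α : K}
    (hp : ∀ i ∈ N, (p i).Monic ∧ (p i).natDegree = i)
    (hirr : ∀ i ∈ N, P.IrreducibleAt (p i)) (hα : P.Vanishes α)
    (hφ : Irreducible ((∏ i ∈ N, p i) - C α)) : ((∏ i ∈ N, p i) - C α).Separable := by
  have : Finite P.ResidueField := Module.finite_of_finite k
  obtain ⟨q, hmap, hq, hred⟩ := exists_lift_of_irreducibleAt hp hirr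
  obtain ⟨a, rfl, ha⟩ := hα
  rw [separable_iff_derivative_ne_zero hφ]
  intro h0
  have hsep : (P.reduction (∏ i ∈ N, q i)).Separable := by
    rw [map_prod]
    refine separable_prod' (fun i hi j hj hij => ?_) fun i hi =>
      PerfectField.separable_of_irreducible (hred i hi)
    refine ((hred i hi).coprime_iff_not_dvd).2 fun h => ?_
    refine not_reduction_dvd_prod_erase hq hred hi (h.trans (_root_.map_dvd _ ?_))
    exact Finset.dvd_prod_of_mem q (Finset.mem_erase.2 ⟨hij.symm, hj⟩)
  rw [prod_sub_C_eq_map hmap, derivative_map, Polynomial.map_eq_zero_iff Subtype.val_injective] at h0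
  have h1 : derivative (P.reduction (∏ i ∈ N, q i)) = 0 := by
    have h2 := congrArg P.reduction h0
    rw [map_zero, derivative_sub, derivative_C, sub_zero] at h2
    rw [← h2]
    exact derivative_map _ _
  rw [Polynomial.Separable, h1, isCoprime_zero_right] at hsep
  have h2 : ∀ i ∈ N, IsUnit (P.reduction (q i)) := fun i hi =>
    isUnit_of_dvd_unit (_root_.map_dvd _ (Finset.dvd_prod_of_mem q hi)) hsep
  have hN : N = ∅ := Finset.eq_empty_of_forall_notMem fun i hi => (hred i hi).not_isUnit (h2 i hi)
  rw [hN, Finset.prod_empty, ← map_one C, ← map_sub] at hφ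
  exact not_irreducible_C _ hφ

end Place

/-! ### The compositum -/

theorem adjoin_algebraMap_eq_top {F F' E E' : Type*} [Field F] [Field F'] [Field E] [Field E']
    [Algebra F F'] [Algebra F E] [Algebra F E'] [Algebra F' E'] [Algebra E E']
    [IsScalarTower F F' E'] [IsScalarTower F E E'] {z : E}
    (hE : IntermediateField.adjoin F {z} = ⊤)
    (hE' : (IsScalarTower.toAlgHom F E E').fieldRange ⊔
      (IsScalarTower.toAlgHom F F' E').fieldRange = ⊤) :
    IntermediateField.adjoin F' {algebraMap E E' z} = ⊤ := by
  refine (IntermediateField.restrictScalars_eq_top_iff (K := F)).1 (top_unique ?_)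
  rw [← hE']
  refine sup_le ?_ ?_
  · rw [AlgHom.fieldRange_eq_map, ← hE, IntermediateField.adjoin_map,
      IntermediateField.adjoin_le_iff, Set.image_singleton, Set.singleton_subset_iff]
    exact IntermediateField.mem_adjoin_simple_self F' (algebraMap E E' z)
  · rintro _ ⟨x, rfl⟩
    exact (IntermediateField.adjoin F' {algebraMap E E' z}).algebraMap_mem x

end AlgFunctionField

open AlgFunctionField AlgFunctionField.Place Polynomial in
theorem proposition5p12
    {k F F' E E' : Type*} [Field k] [Finite k]
    [Field F] [Field F'] [Field E] [Field E']
    [Algebra k F] [Algebra k F'] [Algebra k E] [Algebra k E']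
    [Algebra F F'] [Algebra F E] [Algebra F E'] [Algebra F' E'] [Algebra E E']
    [IsScalarTower k F F'] [IsScalarTower k F E] [IsScalarTower k F E']
    [IsScalarTower F F' E'] [IsScalarTower F E E']
    -- `F / k` is a function field over the finite field `k`, and `F' / F` is finite separable
    (hF : AlgFunctionField.IsFunctionField k F)
    [FiniteDimensional F F'] [Algebra.IsSeparable F F']
    (S : Set (AlgFunctionField.Place k F)) (hS : S.Finite)
    (N : Finset ℕ) (m : ℕ) (hm : m = ∑ i ∈ N, i)
    -- the rational place `Q` and its rational extension `Q'` in `F'`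
    (Q : AlgFunctionField.Place k F) (hQ : Q.deg = 1)
    (Q' : AlgFunctionField.Place k F') (hQ' : Q'.deg = 1) (hQ'Q : Q'.LiesOver Q)
    (he : Nat.Coprime m (Q'.ramificationIdx Q))
    -- the polynomials `p_i`
    (p : ℕ → Polynomial F) (hp : ∀ i ∈ N, (p i).Monic ∧ (p i).natDegree = i)
    (hpS : ∀ P ∈ S, ∀ i ∈ N, P.IrreducibleAt (p i))
    (hpQ : ∀ i ∈ N, Q.IntegralAt (p i))
    -- the element `α`
    (α : F) (hαS : ∀ P ∈ S, P.Vanishes α)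
    (hαQ : Q.ord α < 0) (hαm : Int.gcd (Q.ord α) m = 1)
    -- `E = F(z)`, where `z` is a root of `∏ p_i - α`
    (z : E) (hz : Polynomial.aeval z ((∏ i ∈ N, p i) - Polynomial.C α) = 0)
    (hE : IntermediateField.adjoin F {z} = ⊤)
    -- `E'` is the compositum of `E` and `F'`
    (hE' : (IsScalarTower.toAlgHom F E E').fieldRange ⊔
      (IsScalarTower.toAlgHom F F' E').fieldRange = ⊤) :
    (S.Nonempty → Algebra.IsSeparable F E') ∧
    (Q.TotallyRamified E ∧ Module.finrank F E = m ∧ Module.finrank F' E' = m ∧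
      ∀ x : E', IsAlgebraic k x → x ∈ (algebraMap k E').range) ∧
    (∀ P ∈ S, ∀ i ∈ N, ∃! R : AlgFunctionField.Place k E,
      R.LiesOver P ∧ R.deg = i * P.deg) ∧
    (∀ P ∈ S, P.SplitsCompletely F' →
      ∀ R : AlgFunctionField.Place k E, R.LiesOver P → R.SplitsCompletely E') := by
  classical
  subst hm
  have hkF'E' : IsScalarTower k F' E' := IsScalarTower.of_algebraMap_eq fun c => by
    rw [IsScalarTower.algebraMap_apply k F E', IsScalarTower.algebraMap_apply F F' E',
      ← IsScalarTower.algebraMap_apply k F F']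
  have hkEE' : IsScalarTower k E E' := IsScalarTower.of_algebraMap_eq fun c => by
    rw [IsScalarTower.algebraMap_apply k F E', IsScalarTower.algebraMap_apply F E E',
      ← IsScalarTower.algebraMap_apply k F E]
  -- the data over `F`
  have hdvr := fun P : Place k F => P.isDiscreteValuationRing hF
  have hg : (∏ i ∈ N, p i).Monic := monic_prod_of_monic _ _ fun i hi => (hp i hi).1
  have hdeg : (∏ i ∈ N, p i).natDegree = ∑ i ∈ N, i := by
    rw [natDegree_prod_of_monic _ _ fun i hi => (hp i hi).1]
    exact Finset.sum_congr rfl fun i hi => (hp i hi).2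
  have hgQ : Q.IntegralAt (∏ i ∈ N, p i) := integralAt_prod hpQ
  have hz' : aeval z (∏ i ∈ N, p i) = algebraMap F E α := by
    rwa [map_sub, aeval_C, sub_eq_zero] at hz
  rw [← hdeg] at hαm he ⊢
  have hrank := finrank_eq_of_ord_neg hg hgQ hαQ hz' hαm hE
  have hmin := minpoly_eq_of_ord_neg hg hgQ hαQ hz' hαm
  have hpos := natDegree_pos_of_ord_neg hg hαQ hz'
  have hfinE : FiniteDimensional F E := Module.finite_of_finrank_pos (hrank ▸ hpos)
  have hdvrE := fun P : Place k E =>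
    P.isDiscreteValuationRing (hF.of_finiteDimensional E)
  -- the data over `F'`
  have hdvrF' := fun P : Place k F' =>
    P.isDiscreteValuationRing (hF.of_finiteDimensional F')
  have hE'z : IntermediateField.adjoin F' {algebraMap E E' z} = ⊤ :=
    adjoin_algebraMap_eq_top hE hE'
  have hp' : ∀ i ∈ N, ((p i).map (algebraMap F F')).Monic ∧
      ((p i).map (algebraMap F F')).natDegree = i := fun i hi =>
    ⟨(hp i hi).1.map _, by rw [natDegree_map, (hp i hi).2]⟩
  have hdeg' : ((∏ i ∈ N, p i).map (algebraMap F F')).natDegree = (∏ i ∈ N, p i).natDegree :=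
    natDegree_map _
  have hzE' : aeval (algebraMap E E' z) ((∏ i ∈ N, p i).map (algebraMap F F')) =
      algebraMap F' E' (algebraMap F F' α) := by
    rw [aeval_map_algebraMap, aeval_algebraMap_apply, hz', ← IsScalarTower.algebraMap_apply,
      ← IsScalarTower.algebraMap_apply]
  have hαQ' : Q'.ord (algebraMap F F' α) < 0 := by
    have hα0 := ne_zero_of_ord_neg hαQ
    rw [Q'.ord_neg_iff (by simpa using hα0), ← not_le, hQ'Q.valuation_le_one_iff, not_le]
    exact one_lt_valuation_of_ord_neg hαQ
  have hαm' : Int.gcd (Q'.ord (algebraMap F F' α))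
      ((∏ i ∈ N, p i).map (algebraMap F F')).natDegree = 1 := by
    rw [hdeg', hQ'Q.ord_algebraMap, ← Int.isCoprime_iff_gcd_eq_one]
    exact (Nat.isCoprime_iff_coprime.2 he.symm).mul_left (Int.isCoprime_iff_gcd_eq_one.2 hαm)
  have hgQ' := hQ'Q.integralAt_map hgQ
  have hrank' := finrank_eq_of_ord_neg (hg.map _) hgQ' hαQ' hzE' hαm' hE'z
  have hmin' := minpoly_eq_of_ord_neg (hg.map _) hgQ' hαQ' hzE' hαm'
  rw [hdeg'] at hrank'
  have hfinE' : FiniteDimensional F' E' := Module.finite_of_finrank_pos (hrank' ▸ hpos)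
  have hfinFE' : FiniteDimensional F E' := FiniteDimensional.trans F F' E'
  have hfinEE' : FiniteDimensional E E' := FiniteDimensional.right F E E'
  have hdvrE' := fun P : Place k E' =>
    P.isDiscreteValuationRing (hF.of_finiteDimensional E')
  have hEE' : Module.finrank E E' = Module.finrank F F' := by
    have h1 := Module.finrank_mul_finrank F E E'
    rw [← Module.finrank_mul_finrank F F' E', hrank, hrank', mul_comm] at h1
    exact Nat.eq_of_mul_eq_mul_right hpos h1
  refine ⟨?_, ⟨totallyRamified_of_ord_neg hg hgQ hαQ hz' hαm hE, hrank, hrank', fun x hx =>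
    mem_range_algebraMap_of_isAlgebraic_of_ord_neg hQ' (hg.map _) hgQ' hαQ' hzE' hαm' hE'z hx⟩,
    ?_, ?_⟩
  · rintro ⟨P, hP⟩
    have hsep : IsSeparable F z := by
      have hirr := minpoly.irreducible (Algebra.IsIntegral.isIntegral (R := F) z)
      rw [hmin] at hirr
      rw [IsSeparable, hmin]
      exact separable_prod_sub_C (P.finite_residueField hF) hp (hpS P hP) (hαS P hP) hirr
    have hsepE : IsSeparable F (algebraMap E E' z) := by
      rwa [IsSeparable, minpoly.algebraMap_eq (algebraMap E E').injective]
    have h1 : Algebra.IsSeparable F' E' := by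
      have h2 := (IntermediateField.isSeparable_adjoin_simple_iff_isSeparable F' E').2
        (hsepE.tower_top F')
      rw [hE'z] at h2
      exact AlgEquiv.Algebra.isSeparable IntermediateField.topEquiv
    exact Algebra.IsSeparable.trans F F' E'
  · intro P hP i hi
    obtain ⟨R, hR, hRi⟩ := exists_liesOver_valuation_aeval_lt_one hp (hpS P hP) (hαS P hP) hmin hi
    -- a place of degree `i * deg P` is a zero of `p_i(z)`, because `deg P` is finite and nonzero
    refine ⟨R, ⟨hR, hR.deg_eq_of_valuation_aeval_lt_one hp (hpS P hP) (hαS P hP) hmin hE hi hRi⟩,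
      fun R' ⟨hR', hdegR'⟩ => ?_⟩
    obtain ⟨j, hj, hRj⟩ := hR'.exists_valuation_aeval_lt_one (hpS P hP) (hαS P hP)
      (hR'.mem_ring_of_minpoly_eq hp (hpS P hP) (hαS P hP) hmin) hz'
    rw [hR'.deg_eq_of_valuation_aeval_lt_one hp (hpS P hP) (hαS P hP) hmin hE hj hRj] at hdegR'
    have hres := P.finite_residueField hF
    obtain rfl : j = i := Nat.eq_of_mul_eq_mul_right
      (Module.finrank_pos : 0 < Module.finrank k P.ResidueField) hdegR'
    exact hR'.eq_of_valuation_aeval_lt_one hR hp (hpS P hP) (hαS P hP) hmin hE hj hRj hRi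
  · intro P hP hsplit R hR
    obtain ⟨i, hi, hRi⟩ := hR.exists_valuation_aeval_lt_one (hpS P hP) (hαS P hP)
      (hR.mem_ring_of_minpoly_eq hp (hpS P hP) (hαS P hP) hmin) hz'
    have hval : ∀ (T : Place k E') (T₀ : Place k E), T.LiesOver T₀ →
        (T.ring.valuation (aeval (algebraMap E E' z) ((p i).map (algebraMap F F'))) < 1 ↔
          T₀.ring.valuation (aeval z (p i)) < 1) := fun T T₀ hT => by
      rw [aeval_map_algebraMap, aeval_algebraMap_apply, hT.valuation_lt_one_iff]
    rw [Polynomial.map_prod] at hmin'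
    have hirr' : ∀ P' : Place k F', P'.LiesOver P →
        ∀ i ∈ N, P'.IrreducibleAt ((p i).map (algebraMap F F')) := fun P' hP' i hi =>
      hP'.irreducibleAt_map (fun y hy => hsplit.exists_valuation_sub_algebraMap_lt_one hP' hy)
        (hpS P hP i hi)
    have hα' : ∀ P' : Place k F', P'.LiesOver P → P'.Vanishes (algebraMap F F' α) :=
      fun P' hP' => P'.vanishes_iff.2 (hP'.valuation_lt_one_iff.2 (P.vanishes_iff.1 (hαS P hP)))
    -- `T` is the only place over its restriction to `F'` which is a zero of `p_i(z)`, and `R` is the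
    -- only such place over `P`
    have hbij : Set.BijOn (fun T : Place k E' => T.restrict F') {T | T.LiesOver R}
        {P' | P'.LiesOver P} := by
      refine ⟨fun T hT => ?_, fun T hT T' hT' h => ?_, fun P' hP' => ?_⟩
      · exact (liesOver_restrict T).of_tower (hT.trans hR)
      · have hT₀ : (T.restrict F').LiesOver P := (liesOver_restrict T).of_tower (hT.trans hR)
        have hTT' : T'.LiesOver (T.restrict F') := by
          rw [show T.restrict F' = T'.restrict F' from h]
          exact liesOver_restrict T'
        exact (liesOver_restrict T).eq_of_valuation_aeval_lt_one hTT' hp' (hirr' _ hT₀)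
          (hα' _ hT₀) hmin' hE'z hi ((hval T R hT).2 hRi) ((hval T' R hT').2 hRi)
      · obtain ⟨T, hT, hTi⟩ := exists_liesOver_valuation_aeval_lt_one hp' (hirr' P' hP')
          (hα' P' hP') hmin' hi
        have hT₀ : (T.restrict E).LiesOver P := (liesOver_restrict T).of_tower (hT.trans hP')
        refine ⟨T, ?_, hT.eq_restrict.symm⟩
        have := hT₀.eq_of_valuation_aeval_lt_one hR hp (hpS P hP) (hαS P hP) hmin hE hi
          ((hval T _ (liesOver_restrict T)).1 hTi) hRi
        exact this ▸ liesOver_restrict T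
    rw [SplitsCompletely, hEE', ← hsplit, ← hbij.image_eq,
      hbij.injOn.ncard_image]
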